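/- Let $d\ge 1$ and $n\ge 1$ be integers and $q\in\mathbb{C}\setminus\{0\}$. Let $\mathcal F_{d,n}\cong(\mathbb Z/d\mathbb Z)^n\rtimes B_n$ be the modular framed braid group, generated by the braid generators $\sigma_1,\dots,\sigma_{n-1}$ and commuting framing generators $t_1,\dots,t_n$ with $t_j^d=1$ and $t_j\sigma_i=\sigma_i t_{s_i(j)}$, where $s_i=(i,i+1)$. The Yokonuma--Hecke algebra $Y_{d,n}(q)$ is the quotient of $\mathbb{C}\mathcal F_{d,n}$ by the relations $g_i^2=1+(q-q^{-1})e_ig_i$, where $g_i$ is the class of $\sigma_i$ and $e_i=\frac1d\sum_{s=1}^{d}t_i^st_{i+1}^{-s}$. Let $\mathrm{tr}_d:\bigcup_{n\ge 0} Y_{d,n}(q)\to\mathbb{C}[z,x_1,\dots,x_{d-1}]$ be the Juyumaya trace, that is, the unique linear map with $\mathrm{tr}_d(ab)=\mathrm{tr}_d(ba)$, $\mathrm{tr}_d(1)=1$, and, for $a\in Y_{d,n}(q)$, $\mathrm{tr}_d(ag_n)=z\,\mathrm{tr}_d(a)$ and $\mathrm{tr}_d(at_{n+1}^s)=x_s\,\mathrm{tr}_d(a)$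 for $1\le s\le d-1$. Let $X_D=(\mathrm x_1,\dots,\mathrm x_{d-1})\in\mathbb{C}^{d-1}$ be a solution of the E--system $E^{(m)}=\mathrm x_mE$ ($1\le m\le d-1$), where $E^{(m)}=\frac1d\sum_{s=0}^{d-1}\mathrm x_{m+s}\mathrm x_{d-s}$ and $E=E^{(0)}$, with indices modulo $d$ and $\mathrm x_0=1$ (the solutions are parametrized by the non-empty subsets $D$ of $\mathbb Z/d\mathbb Z$). Write $E_D$ for the value of $E$ at $X_D$ (it equals $1/|D|$), and $\mathrm{tr}_{d,D}$ for $\mathrm{tr}_d$ with $x_s$ specialized to $\mathrm x_s$. Put $\lambda_D=\frac{z-(q-q^{-1})E_D}{z}$ and, for $\alpha\in B_n$ with exponent sum $\epsilon(\alpha)$ and closure $\widehat\alpha$, $$\Theta_{d,D}(q,z)(\widehat\alpha)=\Big(\frac{1}{z\sqrt{\lambda_D}}\Big)^{n-1}\big(\sqrt{\lambda_D}\big)^{\epsilon(\alpha)}\,\mathrm{tr}_{d,D}(\alpha),$$ where $\alpha$ is mapped to $Y_{d,n}(q)$ by $\sigma_i\mapsto g_i$. The Homflypt polynomial is $P(q,z)=\Theta_{1,\{0\}}(q,z)$;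 here $Y_{1,n}(q)$ is the Iwahori--Hecke algebra and $\mathrm{tr}_{1,\{0\}}$ the Ocneanu trace. Theorem. If $\alpha\in B_n$ and $\widehat\alpha$ is a knot, then $$\Theta_{d,D}(q,z)(\widehat\alpha)=\Theta_{1,\{0\}}(q,z/E_D)(\widehat\alpha)=P(q,z/E_D)(\widehat\alpha).$$ Here $z$ may be an indeterminate or any element of an extension field of $\mathbb{C}$ with $z\ne0$ and $\lambda_D\neq 0$; the equality holds for every choice of the square root on each side. Equivalently, if $q^2\neq1$, in the variables $(q,\lambda)$ the invariant equals the Homflypt polynomial: for $\lambda\ne 0,1$, the value of $\Theta_{d,D}$ on $\widehat\alpha$ at $z=\frac{(q-q^{-1})E_D}{1-\lambda}$ equals the value of $P$ on $\widehat\alpha$ at $z=\frac{q-q^{-1}}{1-\lambda}$. -/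

import Mathlib

noncomputable section

namespace YH

/-- The left strand `i` of the `i`-th elementary braid on `n` strands. -/
def lo {n : ℕ} (i : Fin (n - 1)) : Fin n := ⟨i.1, by omega⟩

/-- The right strand `i + 1` of the `i`-th elementary braid on `n` strands. -/
def hi {n : ℕ} (i : Fin (n - 1)) : Fin n := ⟨i.1 + 1, by omega⟩

/-- The transposition `s_i = (i, i + 1)`. -/
def sTr {n : ℕ} (i : Fin (n - 1)) : Equiv.Perm (Fin n) := Equiv.swap (lo i) (hi i)

/-! ### The classical braid group -/

/-- The braid relations, as words in the free group (`u = v` is recorded as `u * v⁻¹`). -/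
inductive BraidRel (n : ℕ) : FreeGroup (Fin (n - 1)) → Prop
  | braid (i j : Fin (n - 1)) (h : j.1 = i.1 + 1) :
      BraidRel n (FreeGroup.of i * FreeGroup.of j * FreeGroup.of i *
        (FreeGroup.of j * FreeGroup.of i * FreeGroup.of j)⁻¹)
  | comm (i j : Fin (n - 1)) (h : i.1 + 1 < j.1) :
      BraidRel n (FreeGroup.of i * FreeGroup.of j * (FreeGroup.of j * FreeGroup.of i)⁻¹)

/-- The braid group `B_n` on `n` strands. -/
abbrev BraidGroup (n : ℕ) : Type := PresentedGroup {w | BraidRel n w}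

/-! ### The modular framed braid group -/

/-- The word `σ_i` in the free group on the symbols `σ_i`, `t_j`. -/
def fσ {n : ℕ} (i : Fin (n - 1)) : FreeGroup (Fin (n - 1) ⊕ Fin n) := FreeGroup.of (Sum.inl i)

/-- The word `t_j` in the free group on the symbols `σ_i`, `t_j`. -/
def ft {n : ℕ} (j : Fin n) : FreeGroup (Fin (n - 1) ⊕ Fin n) := FreeGroup.of (Sum.inr j)

/-- The defining relations of the modular framed braid group. -/
inductive FramedRel (d n : ℕ) : FreeGroup (Fin (n - 1) ⊕ Fin n) → Prop
  | braid (i j : Fin (n - 1)) (h : j.1 = i.1 + 1) :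
      FramedRel d n (fσ i * fσ j * fσ i * (fσ j * fσ i * fσ j)⁻¹)
  | comm (i j : Fin (n - 1)) (h : i.1 + 1 < j.1) :
      FramedRel d n (fσ i * fσ j * (fσ j * fσ i)⁻¹)
  | framing (i j : Fin n) : FramedRel d n (ft i * ft j * (ft j * ft i)⁻¹)
  | mixed (i : Fin (n - 1)) (j : Fin n) :
      FramedRel d n (ft j * fσ i * (fσ i * ft (sTr i j))⁻¹)
  | modular (j : Fin n) : FramedRel d n (ft j ^ d)

/-- The modular framed braid group `F_{d,n} ≅ (ℤ/d)^n ⋊ B_n`. -/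
abbrev FramedBraidGroup (d n : ℕ) : Type := PresentedGroup {w | FramedRel d n w}

/-- The braiding generator `σ_i` of `F_{d,n}`. -/
def σF (d : ℕ) {n : ℕ} (i : Fin (n - 1)) : FramedBraidGroup d n := PresentedGroup.of (Sum.inl i)

/-- The framing generator `t_j` of `F_{d,n}`. -/
def tF (d : ℕ) {n : ℕ} (j : Fin n) : FramedBraidGroup d n := PresentedGroup.of (Sum.inr j)

theorem mk_fσ (d : ℕ) {n : ℕ} (i : Fin (n - 1)) :
    PresentedGroup.mk {w | FramedRel d n w} (fσ i) = σF d i := rfl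

theorem mk_ft (d : ℕ) {n : ℕ} (j : Fin n) :
    PresentedGroup.mk {w | FramedRel d n w} (ft j) = tF d j := rfl

theorem framed_rel {d n : ℕ} {w : FreeGroup (Fin (n - 1) ⊕ Fin n)} (h : FramedRel d n w) :
    PresentedGroup.mk {w | FramedRel d n w} w = 1 :=
  PresentedGroup.one_of_mem h

theorem σF_braid (d : ℕ) {n : ℕ} (i j : Fin (n - 1)) (h : j.1 = i.1 + 1) :
    σF d i * σF d j * σF d i = σF d j * σF d i * σF d j := by
  have := framed_rel (FramedRel.braid (d := d) i j h)
  simp only [map_mul, map_inv, mk_fσ] at this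
  exact mul_inv_eq_one.mp this

theorem σF_comm (d : ℕ) {n : ℕ} (i j : Fin (n - 1)) (h : i.1 + 1 < j.1) :
    σF d i * σF d j = σF d j * σF d i := by
  have := framed_rel (FramedRel.comm (d := d) i j h)
  simp only [map_mul, map_inv, mk_fσ] at this
  exact mul_inv_eq_one.mp this

theorem tF_comm (d : ℕ) {n : ℕ} (i j : Fin n) : tF d i * tF d j = tF d j * tF d i := by
  have := framed_rel (FramedRel.framing (d := d) i j)
  simp only [map_mul, map_inv, mk_ft] at this
  exact mul_inv_eq_one.mp this

theorem tF_σF (d : ℕ) {n : ℕ} (i : Fin (n - 1)) (j : Fin n) :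
    tF d j * σF d i = σF d i * tF d (sTr i j) := by
  have := framed_rel (FramedRel.mixed (d := d) i j)
  simp only [map_mul, map_inv, mk_ft, mk_fσ] at this
  exact mul_inv_eq_one.mp this

theorem tF_pow (d : ℕ) {n : ℕ} (j : Fin n) : tF d j ^ d = 1 := by
  have := framed_rel (FramedRel.modular (d := d) j)
  simpa only [map_pow, mk_ft] using this

/-! ### Maps out of the braid group -/

/-- `B_n → F_{d,n}`, `σ_i ↦ σ_i`: a classical braid is a framed braid with all framings zero. -/
def braidToFramed (d n : ℕ) : BraidGroup n →* FramedBraidGroup d n :=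
  PresentedGroup.toGroup (f := fun i => σF d i) (by
    rintro w (⟨i, j, h⟩ | ⟨i, j, h⟩)
    · simpa only [map_mul, map_inv, FreeGroup.lift_apply_of, mul_inv_eq_one] using σF_braid d i j h
    · simpa only [map_mul, map_inv, FreeGroup.lift_apply_of, mul_inv_eq_one] using σF_comm d i j h)

/-- The permutation of the strands induced by a braid, `σ_i ↦ (i, i + 1)`. -/
def braidPerm (n : ℕ) : BraidGroup n →* Equiv.Perm (Fin n) :=
  PresentedGroup.toGroup (f := fun i => sTr i) (by
    rintro w (⟨i, j, h⟩ | ⟨i, j, h⟩)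
    · simp only [map_mul, map_inv, FreeGroup.lift_apply_of, mul_inv_eq_one]
      have h1 : lo j = hi i := Fin.ext h
      have h2 : lo i ≠ hi i := by simp [lo, hi, Fin.ext_iff]
      have h3 : lo i ≠ hi j := by simp [lo, hi, Fin.ext_iff]; omega
      have h4 : hi i ≠ hi j := by simp [hi, Fin.ext_iff]; omega
      simp only [sTr, h1]
      rw [Equiv.swap_mul_swap_mul_swap h2 h3, Equiv.swap_comm (lo i) (hi i),
        Equiv.swap_comm (hi i) (hi j), Equiv.swap_mul_swap_mul_swap h4.symm h3.symm]
      exact Equiv.swap_comm _ _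
    · simp only [map_mul, map_inv, FreeGroup.lift_apply_of, mul_inv_eq_one]
      refine (Equiv.Perm.Disjoint.commute ?_).eq
      intro k
      by_cases hk : k = lo i ∨ k = hi i
      · right
        refine Equiv.swap_apply_of_ne_of_ne ?_ ?_ <;>
          (rcases hk with rfl | rfl <;> simp [lo, hi, Fin.ext_iff] <;> omega)
      · left
        push Not at hk
        exact Equiv.swap_apply_of_ne_of_ne hk.1 hk.2)

/-- The algebraic sum `ε` of the exponents of the `σ_i` in a braid (written multiplicatively). -/
def braidExpHom (n : ℕ) : BraidGroup n →* Multiplicative ℤ :=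
  PresentedGroup.toGroup (f := fun _ => Multiplicative.ofAdd (1 : ℤ)) (by
    rintro w (⟨i, j, h⟩ | ⟨i, j, h⟩) <;>
      simp only [map_mul, map_inv, FreeGroup.lift_apply_of, mul_inv_cancel])

/-- The exponent sum `ε(α)`. -/
def expSum {n : ℕ} (α : BraidGroup n) : ℤ := Multiplicative.toAdd (braidExpHom n α)

/-- The components of the closure of a braid. Closing up joins the end of each strand to the start
of the strand that sits at the same position, so that a component is an orbit of strands under
the induced permutation. -/
abbrev ClosureComponent {n : ℕ} (α : BraidGroup n) : Type :=
  MulAction.orbitRel.Quotient (Subgroup.zpowers (braidPerm n α)) (Fin n)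

/-- The closure of `α` is a knot: a link with exactly one component. -/
def ClosureIsKnot {n : ℕ} (α : BraidGroup n) : Prop := Nat.card (ClosureComponent α) = 1

/-! ### The Yokonuma–Hecke algebra -/

/-- The element `e_i = (1/d) ∑_{1 ≤ s ≤ d} t_i^s t_{i+1}^{-s}` of the group algebra of `F_{d,n}`. -/
def eF (d : ℕ) {n : ℕ} (i : Fin (n - 1)) : MonoidAlgebra ℂ (FramedBraidGroup d n) :=
  (1 / (d : ℂ)) • ∑ s ∈ Finset.Icc 1 d,
    MonoidAlgebra.of ℂ (FramedBraidGroup d n) (tF d (lo i) ^ s * (tF d (hi i) ^ s)⁻¹)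

/-- The quadratic relations `σ_i² = 1 + (q - q⁻¹) e_i σ_i`. -/
inductive QuadRel (d n : ℕ) (q : ℂ) : MonoidAlgebra ℂ (FramedBraidGroup d n) →
    MonoidAlgebra ℂ (FramedBraidGroup d n) → Prop
  | quad (i : Fin (n - 1)) :
      QuadRel d n q (MonoidAlgebra.of ℂ (FramedBraidGroup d n) (σF d i) ^ 2)
        (1 + (q - q⁻¹) • (eF d i * MonoidAlgebra.of ℂ (FramedBraidGroup d n) (σF d i)))

/-- The Yokonuma–Hecke algebra `Y_{d,n}(q)`: the quotient of the group algebra of `F_{d,n}` by the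
two-sided ideal generated by the quadratic relations. -/
abbrev Y (d n : ℕ) (q : ℂ) : Type := RingQuot (QuadRel d n q)

/-- The natural epimorphism from the group algebra of `F_{d,n}` onto `Y_{d,n}(q)`. -/
def toY (d n : ℕ) (q : ℂ) : MonoidAlgebra ℂ (FramedBraidGroup d n) →ₐ[ℂ] Y d n q :=
  RingQuot.mkAlgHom ℂ (QuadRel d n q)

/-- The natural map from `F_{d,n}` to `Y_{d,n}(q)`. -/
def framedToY (d n : ℕ) (q : ℂ) : FramedBraidGroup d n →* Y d n q :=
  (toY d n q : MonoidAlgebra ℂ (FramedBraidGroup d n) →* Y d n q).comp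
    (MonoidAlgebra.of ℂ (FramedBraidGroup d n))

/-- The generator `g_i` of `Y_{d,n}(q)`. -/
def g (d : ℕ) {n : ℕ} (q : ℂ) (i : Fin (n - 1)) : Y d n q := framedToY d n q (σF d i)

/-- The generator `t_j` of `Y_{d,n}(q)`. -/
def t (d : ℕ) {n : ℕ} (q : ℂ) (j : Fin n) : Y d n q := framedToY d n q (tF d j)

/-- The map `δ` on braids: `σ_i ↦ g_i`. -/
def δ (d n : ℕ) (q : ℂ) : BraidGroup n →* Y d n q := (framedToY d n q).comp (braidToFramed d n)

/-! ### The inclusions `Y_{d,n}(q) ⊂ Y_{d,n+1}(q)` -/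

/-- The `i`-th elementary braid, with one more strand added on the right. -/
def up {n : ℕ} (i : Fin (n - 1)) : Fin (n + 1 - 1) := ⟨i.1, by omega⟩

theorem sTr_up {n : ℕ} (i : Fin (n - 1)) (j : Fin n) :
    sTr (up i) j.castSucc = (sTr i j).castSucc := by
  have h1 : lo (up i) = (lo i).castSucc := rfl
  have h2 : hi (up i) = (hi i).castSucc := rfl
  simp only [sTr, h1, h2]
  exact (Fin.castSucc_injective n).swap_apply _ _ _

/-- The natural map `F_{d,n} → F_{d,n+1}`, `σ_i ↦ σ_i`, `t_j ↦ t_j`. -/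
def inclF (d n : ℕ) : FramedBraidGroup d n →* FramedBraidGroup d (n + 1) :=
  PresentedGroup.toGroup (f := Sum.elim (fun i => σF d (up i)) (fun j => tF d j.castSucc)) (by
    rintro w (⟨i, j, h⟩ | ⟨i, j, h⟩ | ⟨i, j⟩ | ⟨i, j⟩ | ⟨j⟩) <;>
      simp only [fσ, ft, map_mul, map_inv, map_pow, FreeGroup.lift_apply_of, Sum.elim_inl,
        Sum.elim_inr, mul_inv_eq_one]
    · exact σF_braid d _ _ h
    · exact σF_comm d _ _ h
    · exact tF_comm d _ _
    · rw [tF_σF, sTr_up]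
    · exact tF_pow d _)

theorem inclF_σF (d n : ℕ) (i : Fin (n - 1)) : inclF d n (σF d i) = σF d (up i) :=
  PresentedGroup.toGroup.of _

theorem inclF_tF (d n : ℕ) (j : Fin n) : inclF d n (tF d j) = tF d j.castSucc :=
  PresentedGroup.toGroup.of _

/-- The map induced by `F_{d,n} → F_{d,n+1}` on group algebras. -/
def inclA (d n : ℕ) : MonoidAlgebra ℂ (FramedBraidGroup d n) →ₐ[ℂ]
    MonoidAlgebra ℂ (FramedBraidGroup d (n + 1)) :=
  MonoidAlgebra.lift ℂ (MonoidAlgebra ℂ (FramedBraidGroup d (n + 1))) (FramedBraidGroup d n)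
    ((MonoidAlgebra.of ℂ (FramedBraidGroup d (n + 1))).comp (inclF d n))

theorem inclA_of (d n : ℕ) (w : FramedBraidGroup d n) :
    inclA d n (MonoidAlgebra.of ℂ (FramedBraidGroup d n) w) =
      MonoidAlgebra.of ℂ (FramedBraidGroup d (n + 1)) (inclF d n w) := by
  rw [inclA, MonoidAlgebra.lift_of]; rfl

theorem inclA_eF (d n : ℕ) (i : Fin (n - 1)) : inclA d n (eF d i) = eF d (up i) := by
  simp only [eF, map_smul, map_sum, inclA_of]
  simp only [map_mul, map_inv, map_pow, inclF_tF]
  rfl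

/-- The natural inclusion `Y_{d,n}(q) → Y_{d,n+1}(q)`. -/
def incl (d n : ℕ) (q : ℂ) : Y d n q →ₐ[ℂ] Y d (n + 1) q :=
  RingQuot.liftAlgHom ℂ ⟨(toY d (n + 1) q).comp (inclA d n), by
    rintro _ _ ⟨i⟩
    simp only [AlgHom.comp_apply, map_pow, map_add, map_one, map_smul, map_mul, inclA_of,
      inclA_eF, inclF_σF]
    have := RingQuot.mkAlgHom_rel ℂ (QuadRel.quad (d := d) (n := n + 1) (q := q) (up i))
    simp only [map_pow, map_add, map_one, map_smul, map_mul] at this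
    exact this⟩

/-! ### Markov traces -/

/-- The rules of a Markov trace on `⋃ₙ Y_{d,n}(q)` with parameters `z` and `x_s`. A linear map on the
union is a family of linear maps on the `Y_{d,n}(q)` compatible with the inclusions. -/
structure IsMarkovTrace (d : ℕ) (q : ℂ) {R : Type} [CommRing R] [Algebra ℂ R] (z : R)
    (x : ZMod d → R) (tr : (n : ℕ) → Y d n q →ₗ[ℂ] R) : Prop where
  compat : ∀ (n : ℕ) (a : Y d n q), tr (n + 1) (incl d n q a) = tr n a
  comm : ∀ (n : ℕ) (a b : Y d n q), tr n (a * b) = tr n (b * a)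
  one : ∀ n : ℕ, tr n 1 = 1
  markov : ∀ (n : ℕ) (a : Y d (n + 1) q),
    tr (n + 2) (incl d (n + 1) q a * g d q (n := n + 2) (Fin.last n)) = z * tr (n + 1) a
  framing : ∀ (n : ℕ) (a : Y d n q) (s : ℕ), 1 ≤ s → s < d →
    tr (n + 1) (incl d n q a * t d q (Fin.last n) ^ s) = x (s : ZMod d) * tr n a

/-- The polynomial ring `ℂ[z, x_1, …, x_{d-1}]`; the variable `none` is `z` and `some s` is `x_s`. -/
abbrev TraceRing (d : ℕ) : Type := MvPolynomial (Option {s : ZMod d // s ≠ 0}) ℂ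

/-- The indeterminates `x_s`, with the convention `x_0 = 1`. -/
def xVar (d : ℕ) (s : ZMod d) : TraceRing d :=
  if h : s = 0 then 1 else MvPolynomial.X (some ⟨s, h⟩)

open Classical in
/-- The Juyumaya trace `tr_d`: the unique family of linear maps
`Y_{d,n}(q) → ℂ[z, x_1, …, x_{d-1}]` that obeys the rules of a Markov trace. -/
def juyumayaTrace (d : ℕ) (q : ℂ) : (n : ℕ) → Y d n q →ₗ[ℂ] TraceRing d :=
  if h : ∃ tr : (n : ℕ) → Y d n q →ₗ[ℂ] TraceRing d,
      IsMarkovTrace d q (MvPolynomial.X none) (xVar d) tr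
  then h.choose else fun _ => 0

/-! ### The E-system -/

/-- `E^{(m)} = (1/d) ∑_{0 ≤ s < d} x_{m+s} x_{d-s}`, with indices modulo `d`. -/
def Esum (d : ℕ) (x : ZMod d → ℂ) (m : ZMod d) : ℂ :=
  (1 / (d : ℂ)) * ∑ s ∈ Finset.range d, x (m + (s : ZMod d)) * x ((d : ZMod d) - (s : ZMod d))

/-- `E = E^{(0)}`. -/
def E (d : ℕ) (x : ZMod d → ℂ) : ℂ := Esum d x 0

/-- `(x_1, …, x_{d-1})`, extended by `x_0 = 1`, is a solution of the E-system. -/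
structure IsESolution (d : ℕ) (x : ZMod d → ℂ) : Prop where
  zero : x 0 = 1
  eqn : ∀ m : ZMod d, m ≠ 0 → Esum d x m = x m * E d x

/-- The trace `tr_d` with the parameters `x_s` specialized to complex numbers, with values in
`ℂ[z]`. -/
def specTrace (d : ℕ) (q : ℂ) (x : ZMod d → ℂ) (n : ℕ) : Y d n q →ₗ[ℂ] Polynomial ℂ :=
  (MvPolynomial.aeval (fun v : Option {s : ZMod d // s ≠ 0} =>
    v.elim Polynomial.X (fun s => Polynomial.C (x s.1)))).toLinearMap ∘ₗ juyumayaTrace d q n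

/-! ### The invariants -/

/-- `λ = (z - (q - q⁻¹) E) / z`. -/
def lam {K : Type*} [Field K] [Algebra ℂ K] (q E : ℂ) (z : K) : K :=
  (z - algebraMap ℂ K ((q - q⁻¹) * E)) / z

/-- The value of `Θ_{d,D}(q, z)` on the closure of `α ∈ B_n`,
`Λ^(n-1) (√λ)^ε(α) tr(δ(α))` with `Λ = 1 / (z √λ)`. Here `z` lies in an arbitrary extension
field of `ℂ` (for instance an indeterminate), and `r` is a square root of `λ` in that field. -/
def Theta {K : Type*} [Field K] [Algebra ℂ K] (d : ℕ) (q : ℂ) (x : ZMod d → ℂ) (z r : K)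
    {n : ℕ} (α : BraidGroup n) : K :=
  (1 / (z * r)) ^ ((n : ℤ) - 1) * r ^ expSum α *
    Polynomial.aeval z (specTrace d q x n (δ d n q α))

/-- The Homflypt polynomial `P(q, z)` of the closure of `α`: the invariant for `d = 1`, in which case
the algebras are the Iwahori–Hecke algebras and the trace is the Ocneanu trace. -/
def Homflypt {K : Type*} [Field K] [Algebra ℂ K] (q : ℂ) (z r : K) {n : ℕ} (α : BraidGroup n) : K :=
  Theta 1 q (fun _ => 1) z r α

end YH

end

noncomputable section

namespace YH

/-! ### Generators of the framed braid groups -/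

/-! Let χ be the standard additive character of ℤ/d. For each strand `j` the elements `colour q k
j`, averages of the powers of `t_j` against χ, are idempotents whose sum over `k` is 1. Pulling one
of them through a braid carries it along the strand, so a trace cannot tell apart positions on the
same component of the closure. For a knot, one projection of colour `k` can therefore be replaced by
projections of colour `k` on all strands (`fieldTrace_allColour_of_knot`). That product is central,
and `toHecke` sends every `t_j` to χ(k) and every `e_i` to 1. The Markov rules show that the
colour-`k` part of the trace is `c_k^n` times the Ocneanu trace with parameter `z/E`
(`fieldTrace_allColour`), where `c_k` is a Fourier coefficient of the solution. The E-system gives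
`c_k² = E c_k` (`fourier_sq`), and the `c_k` sum to 1, so the sum of the `c_k^n` is `E^(n-1)`, which
is exactly the change of normalization from `z` to `z/E`. The choice of square roots is harmless
because a knot has exponent sum congruent to `n - 1` modulo 2.

All this requires that the Markov trace exists, and that is the longer half of the proof. The framed
braid groups act on tensor powers of a space with `N k` basis vectors of colour `k`: the braiding is
of Hecke type within a colour and a plain flip between colours. A trace weighted by a geometric
progression in each colour obeys Markov rules (`wtTrace_incl_g`, `wtTrace_incl_t`), but only at
special parameters. The trace of a fixed framed braid is polynomial in the parameters
(`B_le_polyMats`) and the special parameters are Zariski dense (`eq_of_eval_val`), so the rules hold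
for the generic polynomials. These are then specialized to the wanted `q`, `z` and `x_s`
(`yTrace_isMarkovTrace`).

Both halves rest on `B_le_span_std`: with one more strand, the algebra is spanned by the elements `a
t^s` and `a g b` with `a`, `b` from the smaller one. It is stated for abstract towers so that it
serves the tensor representations and the Yokonuma–Hecke algebras alike. -/

theorem framed_generated (d n : ℕ) (H : Subgroup (FramedBraidGroup d n))
    (hσ : ∀ i, σF d i ∈ H) (ht : ∀ j, tF d j ∈ H) (w : FramedBraidGroup d n) : w ∈ H := by
  refine PresentedGroup.generated_by _ H ?_ w
  rintro (i | j)
  · exact hσ i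
  · exact ht j

/-- The index of the last braiding generator of `F_{d,n+2}`. -/
abbrev top (n : ℕ) : Fin (n + 2 - 1) := Fin.last n

theorem up_or_eq_top {n : ℕ} (i : Fin (n + 2 - 1)) :
    (∃ k : Fin (n + 1 - 1), i = up k) ∨ i = top n := by
  rcases Nat.lt_or_ge i.1 n with h | h
  · exact Or.inl ⟨⟨i.1, by omega⟩, rfl⟩
  · exact Or.inr (Fin.ext (by have := i.2; simp; omega))

theorem lo_top (n : ℕ) : lo (n := n + 2) (top n) = (Fin.last n).castSucc := rfl

theorem hi_top (n : ℕ) : hi (n := n + 2) (top n) = Fin.last (n + 1) := rfl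

theorem tF_last_mul_inclF (d n : ℕ) (w : FramedBraidGroup d n) :
    tF d (Fin.last n) * inclF d n w = inclF d n w * tF d (Fin.last n) := by
  have := framed_generated d n
    ((Subgroup.centralizer {tF d (Fin.last n)}).comap (inclF d n)) ?_ ?_ w
  · rw [Subgroup.mem_comap, Subgroup.mem_centralizer_iff] at this
    exact this _ rfl
  · intro i
    rw [Subgroup.mem_comap, Subgroup.mem_centralizer_singleton_iff, inclF_σF, tF_σF, sTr,
      Equiv.swap_apply_of_ne_of_ne]
    · simp [lo, up, Fin.ext_iff]; omega
    · simp [hi, up, Fin.ext_iff]; omega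
  · intro j
    rw [Subgroup.mem_comap, Subgroup.mem_centralizer_singleton_iff, inclF_tF, tF_comm]

theorem σF_top_mul_inclF_inclF (d n : ℕ) (w : FramedBraidGroup d n) :
    σF d (n := n + 2) (top n) * inclF d (n + 1) (inclF d n w) =
      inclF d (n + 1) (inclF d n w) * σF d (n := n + 2) (top n) := by
  have := framed_generated d n
    ((Subgroup.centralizer {σF d (n := n + 2) (top n)}).comap
      ((inclF d (n + 1)).comp (inclF d n))) ?_ ?_ w
  · rw [Subgroup.mem_comap, Subgroup.mem_centralizer_iff] at this
    exact this _ rfl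
  · intro i
    rw [Subgroup.mem_comap, Subgroup.mem_centralizer_singleton_iff, MonoidHom.comp_apply,
      inclF_σF, inclF_σF]
    exact σF_comm d (n := n + 2) (up (up i)) (top n) (by simp [up]; omega)
  · intro j
    rw [Subgroup.mem_comap, Subgroup.mem_centralizer_singleton_iff, MonoidHom.comp_apply,
      inclF_tF, inclF_tF, tF_σF, sTr, Equiv.swap_apply_of_ne_of_ne]
    · simp [lo, Fin.ext_iff]; omega
    · simp [hi, Fin.ext_iff]; omega

theorem tF_last_mul_σF_top (d n : ℕ) :
    tF d (Fin.last (n + 1)) * σF d (n := n + 2) (top n) =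
      σF d (n := n + 2) (top n) * tF d (Fin.last n).castSucc := by
  rw [tF_σF, sTr, ← hi_top, Equiv.swap_apply_right, lo_top]

theorem tF_castSucc_mul_σF_top (d n : ℕ) :
    tF d (Fin.last n).castSucc * σF d (n := n + 2) (top n) =
      σF d (n := n + 2) (top n) * tF d (Fin.last (n + 1)) := by
  rw [tF_σF, sTr, ← lo_top, Equiv.swap_apply_left, hi_top]

/-! ### Towers of quotients of the group algebras -/

/-- A tower of algebras that receive the framed braid groups and in which the quadratic relations
`σ_i² = 1 + κ ∑_s t_i^s t_{i+1}^{-s} σ_i` hold. -/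
structure Tower (S : Type*) [CommRing S] (d : ℕ) (κ : S) (A : ℕ → Type*) [∀ n, Ring (A n)]
    [∀ n, Algebra S (A n)] where
  /-- The map from the framed braid group. -/
  ρ : ∀ n, FramedBraidGroup d n →* A n
  /-- The structure maps of the tower. -/
  ι : ∀ n, A n →ₐ[S] A (n + 1)
  ι_ρ : ∀ n w, ι n (ρ n w) = ρ (n + 1) (inclF d n w)
  quad : ∀ n (i : Fin (n - 1)), ρ n (σF d i) * ρ n (σF d i) =
    1 + κ • ((∑ s ∈ Finset.Icc 1 d, ρ n (tF d (lo i) ^ s * (tF d (hi i) ^ s)⁻¹)) * ρ n (σF d i))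

namespace Tower

variable {S : Type*} [CommRing S] {d : ℕ} {κ : S} {A : ℕ → Type*} [∀ n, Ring (A n)]
  [∀ n, Algebra S (A n)] (T : Tower S d κ A)

/-- The subalgebra spanned by the image of the framed braid group, as a submodule. -/
def B (n : ℕ) : Submodule S (A n) := Submodule.span S (Set.range (T.ρ n))

theorem ρ_mem (n : ℕ) (w : FramedBraidGroup d n) : T.ρ n w ∈ T.B n :=
  Submodule.subset_span ⟨w, rfl⟩

theorem one_mem (n : ℕ) : (1 : A n) ∈ T.B n := by
  simpa using T.ρ_mem n 1

theorem mul_mem {n : ℕ} {a b : A n} (ha : a ∈ T.B n) (hb : b ∈ T.B n) : a * b ∈ T.B n := by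
  have h := Submodule.mul_mem_mul ha hb
  rw [B, Submodule.span_mul_span] at h
  refine Submodule.span_mono ?_ h
  rintro _ ⟨_, ⟨u, rfl⟩, _, ⟨v, rfl⟩, rfl⟩
  exact ⟨u * v, map_mul _ _ _⟩

theorem ι_mem {n : ℕ} {a : A n} (ha : a ∈ T.B n) : T.ι n a ∈ T.B (n + 1) := by
  induction ha using Submodule.span_induction with
  | mem x hx =>
    obtain ⟨w, rfl⟩ := hx
    rw [ι_ρ]; exact T.ρ_mem _ _
  | zero => simp
  | add x y _ _ hx hy => rw [map_add]; exact add_mem hx hy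
  | smul c x _ hx => rw [map_smul]; exact Submodule.smul_mem _ _ hx

/-- The standard elements of the `(n+1)`-st algebra: `a t_{n+1}^s` and `a g_n b` with `a`, `b` in the
`n`-th algebra. -/
def std : (n : ℕ) → Set (A (n + 1))
  | 0 => {c | ∃ a ∈ T.B 0, ∃ s : ℕ, c = T.ι 0 a * T.ρ 1 (tF d (Fin.last 0)) ^ s}
  | n + 1 => {c | ∃ a ∈ T.B (n + 1), ∃ s : ℕ,
      c = T.ι (n + 1) a * T.ρ (n + 2) (tF d (Fin.last (n + 1))) ^ s} ∪
    {c | ∃ a ∈ T.B (n + 1), ∃ b ∈ T.B (n + 1),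
      c = T.ι (n + 1) a * T.ρ (n + 2) (σF d (top n)) * T.ι (n + 1) b}

theorem std_t {n : ℕ} {a : A n} (ha : a ∈ T.B n) (s : ℕ) :
    T.ι n a * T.ρ (n + 1) (tF d (Fin.last n)) ^ s ∈ Submodule.span S (T.std n) := by
  cases n with
  | zero => exact Submodule.subset_span ⟨a, ha, s, rfl⟩
  | succ n => exact Submodule.subset_span (Or.inl ⟨a, ha, s, rfl⟩)

theorem std_g {n : ℕ} {a b : A (n + 1)} (ha : a ∈ T.B (n + 1)) (hb : b ∈ T.B (n + 1)) :
    T.ι (n + 1) a * T.ρ (n + 2) (σF d (top n)) * T.ι (n + 1) b ∈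
      Submodule.span S (T.std (n + 1)) :=
  Submodule.subset_span (Or.inr ⟨a, ha, b, hb, rfl⟩)

theorem commute_t {n : ℕ} {a : A n} (ha : a ∈ T.B n) :
    Commute (T.ι n a) (T.ρ (n + 1) (tF d (Fin.last n))) := by
  induction ha using Submodule.span_induction with
  | mem x hx =>
    obtain ⟨w, rfl⟩ := hx
    rw [ι_ρ, Commute, SemiconjBy, ← map_mul, ← map_mul, tF_last_mul_inclF]
  | zero => simp
  | add x y _ _ hx hy => rw [map_add]; exact hx.add_left hy
  | smul c x _ hx => rw [map_smul]; exact hx.smul_left c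

theorem commute_g {n : ℕ} {a : A n} (ha : a ∈ T.B n) :
    Commute (T.ι (n + 1) (T.ι n a)) (T.ρ (n + 2) (σF d (top n))) := by
  induction ha using Submodule.span_induction with
  | mem x hx =>
    obtain ⟨w, rfl⟩ := hx
    rw [ι_ρ, ι_ρ, Commute, SemiconjBy, ← map_mul, ← map_mul, σF_top_mul_inclF_inclF]
  | zero => simp
  | add x y _ _ hx hy => rw [map_add, map_add]; exact hx.add_left hy
  | smul c x _ hx => rw [map_smul, map_smul]; exact hx.smul_left c

theorem t_pow_g (n s : ℕ) :
    T.ρ (n + 2) (tF d (Fin.last (n + 1))) ^ s * T.ρ (n + 2) (σF d (top n)) =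
      T.ρ (n + 2) (σF d (top n)) * T.ι (n + 1) (T.ρ (n + 1) (tF d (Fin.last n)) ^ s) := by
  have h : SemiconjBy (T.ρ (n + 2) (σF d (top n))) (T.ρ (n + 2) (tF d (Fin.last n).castSucc))
      (T.ρ (n + 2) (tF d (Fin.last (n + 1)))) := by
    rw [SemiconjBy, ← map_mul, ← map_mul, tF_last_mul_σF_top]
  rw [map_pow, ι_ρ, inclF_tF]
  exact (h.pow_right s).symm

theorem g_t (n : ℕ) :
    T.ρ (n + 2) (σF d (top n)) * T.ρ (n + 2) (tF d (Fin.last (n + 1))) =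
      T.ι (n + 1) (T.ρ (n + 1) (tF d (Fin.last n))) * T.ρ (n + 2) (σF d (top n)) := by
  rw [ι_ρ, inclF_tF, ← map_mul, ← map_mul, tF_castSucc_mul_σF_top]

/-- Right multiplication by `x` preserves the span of the standard elements. -/
def Stable (n : ℕ) (x : A (n + 1)) : Prop :=
  ∀ c ∈ Submodule.span S (T.std n), c * x ∈ Submodule.span S (T.std n)

variable {T}

theorem Stable.of_std {n : ℕ} {x : A (n + 1)}
    (h : ∀ c ∈ T.std n, c * x ∈ Submodule.span S (T.std n)) : T.Stable n x := by
  intro c hc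
  induction hc using Submodule.span_induction with
  | mem c hc => exact h c hc
  | zero => simp
  | add a b _ _ ha hb => rw [add_mul]; exact add_mem ha hb
  | smul k a _ ha => rw [smul_mul_assoc]; exact Submodule.smul_mem _ _ ha

theorem Stable.mul {n : ℕ} {x y : A (n + 1)} (hx : T.Stable n x) (hy : T.Stable n y) :
    T.Stable n (x * y) := fun c hc => by
  rw [← mul_assoc]; exact hy _ (hx c hc)

theorem Stable.one {n : ℕ} : T.Stable n 1 := fun c hc => by rwa [mul_one]

theorem Stable.sub {n : ℕ} {x y : A (n + 1)} (hx : T.Stable n x) (hy : T.Stable n y) :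
    T.Stable n (x - y) := fun c hc => by
  rw [mul_sub]; exact sub_mem (hx c hc) (hy c hc)

theorem Stable.smul {n : ℕ} {x : A (n + 1)} (k : S) (hx : T.Stable n x) :
    T.Stable n (k • x) := fun c hc => by
  rw [mul_smul_comm]; exact Submodule.smul_mem _ _ (hx c hc)

theorem Stable.sum {n : ℕ} {β : Type*} {s : Finset β} {x : β → A (n + 1)}
    (hx : ∀ b ∈ s, T.Stable n (x b)) : T.Stable n (∑ b ∈ s, x b) := fun c hc => by
  rw [Finset.mul_sum]; exact Submodule.sum_mem _ fun b hb => hx b hb c hc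

theorem Stable.pow {n : ℕ} {x : A (n + 1)} (hx : T.Stable n x) (k : ℕ) : T.Stable n (x ^ k) := by
  induction k with
  | zero => rw [pow_zero]; exact Stable.one
  | succ k ih => rw [pow_succ]; exact ih.mul hx

/-! ### Stability of the standard span under the generators -/

variable (T)

/-- In `a g b t` the new framing generator commutes with `b` and turns into the previous framing
generator when it crosses `g`, so it is absorbed into `a`. -/
theorem stable_t_last (n : ℕ) : T.Stable n (T.ρ (n + 1) (tF d (Fin.last n))) := by
  refine Stable.of_std fun c hc => ?_
  cases n with
  | zero =>
    obtain ⟨a, ha, s, rfl⟩ := hc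
    rw [mul_assoc, ← pow_succ]; exact T.std_t ha _
  | succ n =>
    rcases hc with ⟨a, ha, s, rfl⟩ | ⟨a, ha, b, hb, rfl⟩
    · rw [mul_assoc, ← pow_succ]; exact T.std_t ha _
    · rw [mul_assoc, (T.commute_t hb).eq, mul_assoc, ← mul_assoc (T.ρ _ _), g_t, mul_assoc,
        ← mul_assoc, ← map_mul, ← mul_assoc]
      exact T.std_g (T.mul_mem ha (T.ρ_mem _ _)) hb

theorem stable_ι {n : ℕ} {x : A n} (hx : x ∈ T.B n) : T.Stable n (T.ι n x) := by
  refine Stable.of_std fun c hc => ?_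
  cases n with
  | zero =>
    obtain ⟨a, ha, s, rfl⟩ := hc
    rw [mul_assoc, ← ((T.commute_t hx).pow_right s).eq, ← mul_assoc, ← map_mul]
    exact T.std_t (T.mul_mem ha hx) _
  | succ n =>
    rcases hc with ⟨a, ha, s, rfl⟩ | ⟨a, ha, b, hb, rfl⟩
    · rw [mul_assoc, ← ((T.commute_t hx).pow_right s).eq, ← mul_assoc, ← map_mul]
      exact T.std_t (T.mul_mem ha hx) _
    · rw [mul_assoc, ← map_mul]
      exact T.std_g ha (T.mul_mem hb hx)

theorem stable_t (n : ℕ) (j : Fin (n + 1)) : T.Stable n (T.ρ (n + 1) (tF d j)) := by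
  induction j using Fin.lastCases with
  | last => exact T.stable_t_last n
  | cast j => rw [← inclF_tF, ← ι_ρ]; exact T.stable_ι (T.ρ_mem _ _)

/-- Since `t_j^d = 1`, inverses are powers, so stability under `t_j` also covers its inverse and the
sums in the quadratic relation. -/
theorem ρ_tF_inv [NeZero d] {n : ℕ} (j : Fin n) :
    T.ρ n (tF d j)⁻¹ = T.ρ n (tF d j) ^ (d - 1) := by
  rw [← map_pow]
  congr 1
  rw [inv_eq_iff_mul_eq_one, ← pow_succ', Nat.sub_add_cancel (NeZero.one_le), tF_pow]

theorem stable_e [NeZero d] (n : ℕ) (i : Fin (n + 1 - 1)) : T.Stable n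
    (∑ s ∈ Finset.Icc 1 d, T.ρ (n + 1) (tF d (lo i) ^ s * (tF d (hi i) ^ s)⁻¹)) := by
  refine Stable.sum fun s _ => ?_
  rw [← inv_pow, map_mul, map_pow, map_pow, ρ_tF_inv]
  exact ((T.stable_t n _).pow s).mul (((T.stable_t n _).pow _).pow s)

/-- The only hard product is `a g b g`. The factor `b` is expanded in standard elements one level
down. If `b = a' t^s`, both `a'` and `t^s` move out from between the two `g` and the quadratic
relation applies; if `b` contains the previous braiding generator, the braid relation leaves a
single `g`. -/
theorem stable_g_top [NeZero d] (n : ℕ)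
    (ih : T.B (n + 1) ≤ Submodule.span S (T.std n)) :
    T.Stable (n + 1) (T.ρ (n + 2) (σF d (top n))) := by
  refine Stable.of_std fun c hc => ?_
  rcases hc with ⟨a, ha, s, rfl⟩ | ⟨a, ha, b, hb, rfl⟩
  · rw [mul_assoc, t_pow_g, ← mul_assoc, map_pow, ← map_pow]
    exact T.std_g ha (by rw [← map_pow]; exact T.ρ_mem _ _)
  have hb' := ih hb
  clear hb
  induction hb' using Submodule.span_induction with
  | mem b hb =>
    have h1 : ∀ a' ∈ T.B n, ∀ s : ℕ, T.ι (n + 1) a * T.ρ (n + 2) (σF d (top n)) *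
        T.ι (n + 1) (T.ι n a' * T.ρ (n + 1) (tF d (Fin.last n)) ^ s) *
        T.ρ (n + 2) (σF d (top n)) ∈ Submodule.span S (T.std (n + 1)) := by
      intro a' ha' s
      have : T.ι (n + 1) a * T.ρ (n + 2) (σF d (top n)) *
          T.ι (n + 1) (T.ι n a' * T.ρ (n + 1) (tF d (Fin.last n)) ^ s) *
          T.ρ (n + 2) (σF d (top n)) = T.ι (n + 1) (a * T.ι n a') *
            T.ρ (n + 2) (tF d (Fin.last (n + 1))) ^ s +
            κ • (T.ι (n + 1) (a * T.ι n a') * T.ρ (n + 2) (tF d (Fin.last (n + 1))) ^ s *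
              (∑ s ∈ Finset.Icc 1 d, T.ρ (n + 2) (tF d (lo (top n)) ^ s *
                (tF d (hi (top n)) ^ s)⁻¹)) * T.ρ (n + 2) (σF d (top n))) := by
        rw [map_mul, mul_assoc (T.ι (n + 1) a), ← mul_assoc (T.ρ _ _), ← (T.commute_g ha').eq,
          mul_assoc (T.ι (n + 1) (T.ι n a')), ← t_pow_g, ← mul_assoc, ← mul_assoc, ← map_mul,
          mul_assoc _ (T.ρ _ _) (T.ρ _ _), T.quad, mul_add, mul_one, mul_smul_comm]
        simp only [mul_assoc]
      rw [this]
      refine add_mem (T.std_t (T.mul_mem ha (T.ι_mem ha')) s) (Submodule.smul_mem _ _ ?_)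
      rw [mul_assoc, Finset.sum_mul, Finset.mul_sum]
      refine Submodule.sum_mem _ fun k _ => ?_
      -- The inverse framing on the new strand becomes the power `d - 1` and is pushed through `g`
      -- onto the previous strand, so only elements of the smaller algebra surround `g`.
      have h2 : T.ρ (n + 2) (tF d (lo (top n)) ^ k * (tF d (hi (top n)) ^ k)⁻¹) *
          T.ρ (n + 2) (σF d (top n)) = T.ι (n + 1) (T.ρ (n + 1) (tF d (Fin.last n)) ^ k) *
            (T.ρ (n + 2) (σF d (top n)) *
              T.ι (n + 1) ((T.ρ (n + 1) (tF d (Fin.last n)) ^ (d - 1)) ^ k)) := by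
        rw [← inv_pow, map_mul, map_pow, map_pow, ρ_tF_inv, lo_top, hi_top, ← inclF_tF, ← ι_ρ,
          mul_assoc, ← pow_mul, t_pow_g, pow_mul]
        simp only [map_pow]
      have hc : Commute (T.ι (n + 1) (T.ρ (n + 1) (tF d (Fin.last n)) ^ k))
          (T.ρ (n + 2) (tF d (Fin.last (n + 1))) ^ s) :=
        (T.commute_t (by rw [← map_pow]; exact T.ρ_mem _ _)).pow_right s
      rw [h2, mul_assoc, ← mul_assoc (T.ρ _ _ ^ s), ← hc.eq, mul_assoc _ (T.ρ _ _ ^ s),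
        ← mul_assoc (T.ρ _ _ ^ s), t_pow_g, mul_assoc (T.ρ _ _), ← map_mul, ← mul_assoc,
        ← map_mul, ← mul_assoc]
      refine T.std_g (T.mul_mem (T.mul_mem ha (T.ι_mem ha')) ?_) ?_
      · rw [← map_pow]; exact T.ρ_mem _ _
      · simp only [← map_pow, ← map_mul]; exact T.ρ_mem _ _
    cases n with
    | zero =>
      obtain ⟨a', ha', s, rfl⟩ := hb
      exact h1 a' ha' s
    | succ n =>
      rcases hb with ⟨a', ha', s, rfl⟩ | ⟨a', ha', b', hb', rfl⟩
      · exact h1 a' ha' s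
      · have hbr : T.ρ (n + 3) (σF d (top (n + 1))) *
            T.ι (n + 2) (T.ρ (n + 2) (σF d (top n))) * T.ρ (n + 3) (σF d (top (n + 1))) =
            T.ι (n + 2) (T.ρ (n + 2) (σF d (top n))) * T.ρ (n + 3) (σF d (top (n + 1))) *
              T.ι (n + 2) (T.ρ (n + 2) (σF d (top n))) := by
          rw [ι_ρ, inclF_σF]
          simp only [← map_mul]
          rw [σF_braid d (n := n + 3) (up (top n)) (top (n + 1)) (by simp [up])]
        have : T.ι (n + 2) a * T.ρ (n + 3) (σF d (top (n + 1))) *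
            T.ι (n + 2) (T.ι (n + 1) a' * T.ρ (n + 2) (σF d (top n)) * T.ι (n + 1) b') *
            T.ρ (n + 3) (σF d (top (n + 1))) =
            T.ι (n + 2) (a * T.ι (n + 1) a' * T.ρ (n + 2) (σF d (top n))) *
              T.ρ (n + 3) (σF d (top (n + 1))) *
              T.ι (n + 2) (T.ρ (n + 2) (σF d (top n)) * T.ι (n + 1) b') := by
          simp only [map_mul]
          rw [mul_assoc _ _ (T.ρ (n + 3) _), mul_assoc _ (T.ι (n + 2) (T.ι (n + 1) b')),
            (T.commute_g hb').eq, mul_assoc (T.ι (n + 2) a), ← mul_assoc (T.ρ (n + 3) _),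
            ← mul_assoc (T.ρ (n + 3) _), ← (T.commute_g ha').eq]
          calc _ = T.ι (n + 2) a * T.ι (n + 2) (T.ι (n + 1) a') *
                (T.ρ (n + 3) (σF d (top (n + 1))) *
                  T.ι (n + 2) (T.ρ (n + 2) (σF d (top n))) * T.ρ (n + 3) (σF d (top (n + 1)))) *
                T.ι (n + 2) (T.ι (n + 1) b') := by simp only [mul_assoc]
            _ = _ := by rw [hbr]; simp only [mul_assoc]
        rw [this]
        exact T.std_g (T.mul_mem (T.mul_mem ha (T.ι_mem ha')) (T.ρ_mem _ _))
          (T.mul_mem (T.ρ_mem _ _) (T.ι_mem hb'))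
  | zero => simp
  | add x y _ _ hx hy => rw [map_add, mul_add, add_mul]; exact add_mem hx hy
  | smul k x _ hx =>
    rw [map_smul, mul_smul_comm, smul_mul_assoc]; exact Submodule.smul_mem _ _ hx

/-- Multiplying the quadratic relation by `g⁻¹` expresses `g⁻¹` as `g` minus a combination of
framings. -/
theorem stable_g_inv [NeZero d] (n : ℕ) (i : Fin (n + 1 - 1))
    (h : T.Stable n (T.ρ (n + 1) (σF d i))) : T.Stable n (T.ρ (n + 1) (σF d i)⁻¹) := by
  have hinv : T.ρ (n + 1) (σF d i) * T.ρ (n + 1) (σF d i)⁻¹ = 1 := by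
    rw [← map_mul, mul_inv_cancel, map_one]
  have : T.ρ (n + 1) (σF d i)⁻¹ = T.ρ (n + 1) (σF d i) -
      κ • ∑ s ∈ Finset.Icc 1 d, T.ρ (n + 1) (tF d (lo i) ^ s * (tF d (hi i) ^ s)⁻¹) := by
    have := congrArg (· * T.ρ (n + 1) (σF d i)⁻¹) (T.quad (n + 1) i)
    simp only [mul_assoc, add_mul, smul_mul_assoc, hinv, mul_one, one_mul] at this
    rw [this]; abel
  rw [this]
  exact h.sub ((T.stable_e n i).smul κ)

/-- The algebra generated by the first `n + 1` strands is spanned by the standard elements. -/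
theorem B_le_span_std [NeZero d] (n : ℕ) : T.B (n + 1) ≤ Submodule.span S (T.std n) := by
  have key : ∀ n, (∀ i : Fin (n + 1 - 1), T.Stable n (T.ρ (n + 1) (σF d i))) →
      T.B (n + 1) ≤ Submodule.span S (T.std n) := by
    intro n hg
    rw [B, Submodule.span_le]
    rintro _ ⟨w, rfl⟩
    -- Stability under an element does not formally pass to its inverse, so both are demanded to get
    -- a subgroup.
    let H : Subgroup (FramedBraidGroup d (n + 1)) :=
      { carrier := {w | T.Stable n (T.ρ (n + 1) w) ∧ T.Stable n (T.ρ (n + 1) w⁻¹)}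
        mul_mem' := by
          rintro u v ⟨hu, hu'⟩ ⟨hv, hv'⟩
          refine ⟨?_, ?_⟩
          · rw [map_mul]; exact hu.mul hv
          · rw [mul_inv_rev, map_mul]; exact hv'.mul hu'
        one_mem' := by
          refine ⟨?_, ?_⟩ <;> simp only [inv_one, map_one] <;> exact Stable.one
        inv_mem' := by
          rintro u ⟨hu, hu'⟩
          exact ⟨hu', by rwa [inv_inv]⟩ }
    have hw : w ∈ H := framed_generated d (n + 1) H
      (fun i => ⟨hg i, T.stable_g_inv n i (hg i)⟩)
      (fun j => ⟨T.stable_t n j, by rw [ρ_tF_inv]; exact (T.stable_t n j).pow _⟩) w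
    -- The unit is standard (`a = 1`, `s = 0`); multiplying it by `w` puts the image of `w` into the
    -- span.
    have h1 := T.std_t (T.one_mem n) 0
    rw [map_one, pow_zero, mul_one] at h1
    simpa using hw.1 1 h1
  induction n with
  | zero => exact key 0 fun i => i.elim0
  | succ n ih =>
    refine key (n + 1) fun i => ?_
    rcases up_or_eq_top i with ⟨k, rfl⟩ | rfl
    · rw [← inclF_σF, ← ι_ρ]; exact T.stable_ι (T.ρ_mem _ _)
    · exact T.stable_g_top n ih

end Tower

/-! ### The tensor representation -/

/-- Coloured basis vectors: `N k` vectors of each colour `k`. -/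
abbrev Vec {d : ℕ} (N : ZMod d → ℕ) : Type := Σ k : ZMod d, Fin (N k)

/-- The matrices acting on the `n`-th tensor power. -/
abbrev Mat {d : ℕ} (N : ZMod d → ℕ) (n : ℕ) : Type :=
  Matrix (Fin n → Vec N) (Fin n → Vec N) ℂ

/-- The diagonal coefficients of the braiding; the flip is added to them. -/
def brCoeff {d : ℕ} {N : ZMod d → ℕ} (v : ℂ) (a b : Vec N) : ℂ :=
  if a.1 = b.1 then
    if b.2.1 < a.2.1 then v - v⁻¹ else if a.2.1 = b.2.1 then v - 1 else 0
  else 0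

theorem vec_ext {d : ℕ} {N : ZMod d → ℕ} {a b : Vec N} (h : a.1 = b.1) (h' : a.2.1 = b.2.1) :
    a = b := by
  obtain ⟨k, i⟩ := a
  obtain ⟨l, j⟩ := b
  obtain rfl : k = l := h
  obtain rfl : i = j := Fin.ext h'
  rfl

theorem vec_ne {d : ℕ} {N : ZMod d → ℕ} {a b : Vec N} (h : a ≠ b) (h' : a.1 = b.1) :
    a.2.1 ≠ b.2.1 := fun h'' => h (vec_ext h' h'')

/-! ### Scalar identities for the braiding coefficients -/

section brCoeff

variable {d : ℕ} {N : ZMod d → ℕ} {v : ℂ}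

theorem brCoeff_self (a : Vec N) : brCoeff v a a = v - 1 := by simp [brCoeff]

theorem brCoeff_of_ne {a b : Vec N} (h : a ≠ b) :
    brCoeff v a b = if a.1 = b.1 ∧ b.2.1 < a.2.1 then v - v⁻¹ else 0 := by
  have := vec_ne h
  simp only [brCoeff]
  split_ifs <;> first | rfl | (exfalso; grind)

theorem brCoeff_mul_swap {a b : Vec N} (h : a ≠ b) : brCoeff v a b * brCoeff v b a = 0 := by
  have := vec_ne h
  simp only [brCoeff]
  split_ifs <;> first | (exfalso; grind) | ring

theorem brCoeff_sq {a b : Vec N} (h : a ≠ b) :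
    brCoeff v a b ^ 2 = (v - v⁻¹) * brCoeff v a b := by
  have := vec_ne h
  simp only [brCoeff]
  split_ifs <;> first | (exfalso; grind) | ring

/-- For distinct labels the coefficient is `v - v⁻¹` times the indicator of a strict order within
one colour, so this is an identity between order indicators. Only `a = c` is special: the terms with
`v - 1` cancel and `brCoeff_mul_swap` finishes. -/
theorem brCoeff_triple_left {a b c : Vec N} (hab : a ≠ b) (hbc : b ≠ c) :
    brCoeff v a b * brCoeff v b c + brCoeff v a c * brCoeff v b a =
      brCoeff v b c * brCoeff v a c := by
  rcases eq_or_ne a c with rfl | hac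
  · linear_combination brCoeff_mul_swap hab
  have h1 := vec_ne hab
  have h2 := vec_ne hbc
  have h3 := vec_ne hac
  rw [brCoeff_of_ne hab, brCoeff_of_ne hbc, brCoeff_of_ne hac, brCoeff_of_ne hab.symm]
  clear hab hbc hac
  generalize a.2.1 = a₂, b.2.1 = b₂, c.2.1 = c₂ at *
  generalize a.1 = a₁, b.1 = b₁, c.1 = c₁ at *
  split_ifs <;> first | (exfalso; grind) | ring

theorem brCoeff_triple_right {a b c : Vec N} (hab : a ≠ b) (hbc : b ≠ c) :
    brCoeff v a b * brCoeff v a c = brCoeff v b c * brCoeff v a b +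
      brCoeff v a c * brCoeff v c b := by
  rcases eq_or_ne a c with rfl | hac
  · linear_combination -brCoeff_mul_swap hab
  have h1 := vec_ne hab
  have h2 := vec_ne hbc
  have h3 := vec_ne hac
  rw [brCoeff_of_ne hab, brCoeff_of_ne hbc, brCoeff_of_ne hac, brCoeff_of_ne hbc.symm]
  clear hab hbc hac
  generalize a.2.1 = a₂, b.2.1 = b₂, c.2.1 = c₂ at *
  generalize a.1 = a₁, b.1 = b₁, c.1 = c₁ at *
  split_ifs <;> first | (exfalso; grind) | ring

/-- The coefficient identity behind the braid relation. -/
theorem brCoeff_braid (hv : v ≠ 0) (a b c : Vec N) (X Y Z : ℂ)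
    (hab : a = b → Y = X) (hbc : b = c → Z = X) :
    brCoeff v a b * brCoeff v b c * (brCoeff v a b - brCoeff v b c) * X +
      (brCoeff v a b * brCoeff v b c + brCoeff v a c * brCoeff v b a -
        brCoeff v b c * brCoeff v a c) * Y +
      (brCoeff v a b * brCoeff v a c - brCoeff v b c * brCoeff v a b -
        brCoeff v a c * brCoeff v c b) * Z = 0 := by
  have hv' : v * v⁻¹ = 1 := mul_inv_cancel₀ hv
  -- `X`, `Y`, `Z` stand for the entries in the rows `f`, `f ∘ s_i`, `f ∘ s_j`; a swap of equal
  -- labels does nothing, so some of them merge in the degenerate cases.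
  by_cases h : a = b <;> by_cases h' : b = c
  · rw [hab h, hbc h']
    subst h h'
    ring
  · rw [hab h]
    subst h
    rw [brCoeff_self]
    linear_combination (-v * X) * brCoeff_sq (v := v) h' - Z * brCoeff_mul_swap (v := v) h' +
      X * brCoeff v a c * hv'
  · rw [hbc h']
    subst h'
    rw [brCoeff_self]
    linear_combination (v * X) * brCoeff_sq (v := v) h + Y * brCoeff_mul_swap (v := v) h -
      X * brCoeff v a b * hv'
  · linear_combination Y * brCoeff_triple_left (v := v) h h' +
      Z * brCoeff_triple_right (v := v) h h' +
      X * brCoeff v b c * brCoeff_sq (v := v) h - X * brCoeff v a b * brCoeff_sq (v := v) h'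

end brCoeff

/-! ### The defining relations on tensor powers -/

section Rep

variable {d : ℕ} {N : ZMod d → ℕ} {n : ℕ} (v : ℂ)

/-- The matrix of the `i`-th braiding generator. -/
def sigMat (N : ZMod d → ℕ) (i : Fin (n - 1)) : Mat N n := fun f f' =>
  (if f = f' then brCoeff v (f (lo i)) (f (hi i)) else 0) + if f ∘ sTr i = f' then 1 else 0

/-- The matrix of the projection onto the tensors with equal colours at `i` and `i + 1`. -/
def eMat (N : ZMod d → ℕ) (i : Fin (n - 1)) : Mat N n :=
  Matrix.diagonal fun f => if (f (lo i)).1 = (f (hi i)).1 then 1 else 0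

/-- The matrix of the `j`-th framing generator. -/
def tMat [NeZero d] (N : ZMod d → ℕ) (j : Fin n) : Mat N n :=
  Matrix.diagonal fun f => ZMod.stdAddChar (f j).1

variable [NeZero d]

/-- Multiplication by a braiding generator becomes an operation on the rows of an arbitrary matrix.
This is why the relations below are tested after right multiplication by an unspecified `X` in place
of 1. -/
theorem sigMat_mul (i : Fin (n - 1)) (X : Mat N n) (f f' : Fin n → Vec N) :
    (sigMat v N i * X) f f' =
      brCoeff v (f (lo i)) (f (hi i)) * X f f' + X (f ∘ sTr i) f' := by
  simp [Matrix.mul_apply, sigMat, add_mul, Finset.sum_add_distrib]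

theorem lo_ne_hi (i : Fin (n - 1)) : lo i ≠ hi i := by simp [lo, hi, Fin.ext_iff]

theorem sTr_lo (i : Fin (n - 1)) : sTr i (lo i) = hi i := Equiv.swap_apply_left _ _

theorem sTr_hi (i : Fin (n - 1)) : sTr i (hi i) = lo i := Equiv.swap_apply_right _ _

theorem sTr_of_ne {i : Fin (n - 1)} {j : Fin n} (h : j ≠ lo i) (h' : j ≠ hi i) : sTr i j = j :=
  Equiv.swap_apply_of_ne_of_ne h h'

theorem sTr_sTr (i : Fin (n - 1)) (j : Fin n) : sTr i (sTr i j) = j := Equiv.swap_apply_self _ _ _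

theorem comp_sTr_sTr {β : Type*} (i : Fin (n - 1)) (f : Fin n → β) : (f ∘ sTr i) ∘ sTr i = f :=
  funext fun j => congrArg f (sTr_sTr i j)

theorem comp_sTr_of_eq {β : Type*} {i : Fin (n - 1)} {f : Fin n → β} (h : f (lo i) = f (hi i)) :
    f ∘ sTr i = f := by
  funext j
  rw [Function.comp_apply]
  by_cases h1 : j = lo i
  · rw [h1, sTr_lo, h]
  by_cases h2 : j = hi i
  · rw [h2, sTr_hi, h]
  rw [sTr_of_ne h1 h2]

theorem sTr_mul_braid (i j : Fin (n - 1)) (h : j.1 = i.1 + 1) :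
    sTr i * sTr j * sTr i = sTr j * sTr i * sTr j := by
  have h1 : lo j = hi i := Fin.ext h
  have h2 : lo i ≠ hi i := lo_ne_hi i
  have h3 : lo i ≠ hi j := by simp [lo, hi, Fin.ext_iff]; omega
  have h4 : hi i ≠ hi j := by simp [hi, Fin.ext_iff]; omega
  simp only [sTr, h1]
  rw [Equiv.swap_mul_swap_mul_swap h2 h3, Equiv.swap_comm (lo i) (hi i),
    Equiv.swap_comm (hi i) (hi j), Equiv.swap_mul_swap_mul_swap h4.symm h3.symm]
  exact Equiv.swap_comm _ _

/-- Expanding both sides at the row `f`, the terms with two or three swaps agree once `e5`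
identifies the longest ones. What remains lives at `f`, `f ∘ s_i` and `f ∘ s_j` and vanishes by
`brCoeff_braid`. -/
theorem sigMat_braid (hv : v ≠ 0) (i j : Fin (n - 1)) (h : j.1 = i.1 + 1) :
    sigMat v N i * sigMat v N j * sigMat v N i = sigMat v N j * sigMat v N i * sigMat v N j := by
  rw [← mul_one (sigMat v N i * sigMat v N j * sigMat v N i),
    ← mul_one (sigMat v N j * sigMat v N i * sigMat v N j)]
  generalize (1 : Mat N n) = X
  ext f f'
  have h1 : lo j = hi i := Fin.ext h
  have e1 : sTr i (hi j) = hi j :=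
    sTr_of_ne (by simp [lo, hi, Fin.ext_iff]; omega) (by simp [hi, Fin.ext_iff]; omega)
  have e2 : sTr j (lo i) = lo i :=
    sTr_of_ne (by simp [lo, Fin.ext_iff]; omega) (by simp [lo, hi, Fin.ext_iff]; omega)
  have e3 : sTr j (hi i) = hi j := by rw [← h1, sTr_lo]
  have e4 : sTr j (hi j) = hi i := by rw [← h1, sTr_hi]
  have e5 : ((f ∘ sTr i) ∘ sTr j) ∘ sTr i = ((f ∘ sTr j) ∘ sTr i) ∘ sTr j := by
    have := sTr_mul_braid i j h
    funext k
    exact congrArg f (by simpa using congrArg (fun p : Equiv.Perm (Fin n) => p k) this)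
  have key := brCoeff_braid hv (f (lo i)) (f (hi i)) (f (hi j)) (X f f') (X (f ∘ sTr i) f')
    (X (f ∘ sTr j) f') (fun e => by rw [comp_sTr_of_eq e])
    (fun e => by rw [comp_sTr_of_eq (h1 ▸ e)])
  simp only [mul_assoc, sigMat_mul, Function.comp_apply, h1, sTr_lo, sTr_hi, e1, e2, e3, e4,
    comp_sTr_sTr, e5]
  linear_combination key

theorem sTr_comm (i j : Fin (n - 1)) (h : i.1 + 1 < j.1) : sTr i * sTr j = sTr j * sTr i := by
  refine (Equiv.Perm.Disjoint.commute fun k => ?_).eq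
  by_cases hk : k = lo i ∨ k = hi i
  · right
    refine sTr_of_ne ?_ ?_ <;>
      (rcases hk with rfl | rfl <;> simp [lo, hi, Fin.ext_iff] <;> omega)
  · left
    push Not at hk
    exact sTr_of_ne hk.1 hk.2

theorem sigMat_comm (i j : Fin (n - 1)) (h : i.1 + 1 < j.1) :
    sigMat v N i * sigMat v N j = sigMat v N j * sigMat v N i := by
  rw [← mul_one (sigMat v N i * sigMat v N j), ← mul_one (sigMat v N j * sigMat v N i)]
  generalize (1 : Mat N n) = X
  ext f f'
  have e1 : sTr i (hi j) = hi j :=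
    sTr_of_ne (by simp [lo, hi, Fin.ext_iff]; omega) (by simp [hi, Fin.ext_iff]; omega)
  have e2 : sTr i (lo j) = lo j :=
    sTr_of_ne (by simp [lo, Fin.ext_iff]; omega) (by simp [lo, hi, Fin.ext_iff]; omega)
  have e3 : sTr j (hi i) = hi i :=
    sTr_of_ne (by simp [lo, hi, Fin.ext_iff]; omega) (by simp [hi, Fin.ext_iff]; omega)
  have e4 : sTr j (lo i) = lo i :=
    sTr_of_ne (by simp [lo, Fin.ext_iff]; omega) (by simp [lo, hi, Fin.ext_iff]; omega)
  have e5 : (f ∘ sTr i) ∘ sTr j = (f ∘ sTr j) ∘ sTr i := by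
    have := sTr_comm i j h
    funext k
    exact congrArg f (by simpa using congrArg (fun p : Equiv.Perm (Fin n) => p k) this)
  simp only [mul_assoc, sigMat_mul, Function.comp_apply, e1, e2, e3, e4, e5]
  ring

/-- On equal labels the generator acts by `v`, a root of `X² = 1 + (v - v⁻¹) X`. On distinct labels
of one colour it is a two-by-two block whose diagonal entries have sum `v - v⁻¹` and product 0.
Between different colours it is the flip, whose square is 1. -/
theorem sigMat_mul_self (hv : v ≠ 0) (i : Fin (n - 1)) :
    sigMat v N i * sigMat v N i = 1 + (v - v⁻¹) • (eMat N i * sigMat v N i) := by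
  have hv' : v * v⁻¹ = 1 := mul_inv_cancel₀ hv
  suffices H : ∀ X : Mat N n, sigMat v N i * sigMat v N i * X =
      X + (v - v⁻¹) • (eMat N i * sigMat v N i * X) by simpa using H 1
  intro X
  ext f f'
  simp only [mul_assoc, sigMat_mul, Function.comp_apply, sTr_lo, sTr_hi, comp_sTr_sTr,
    Matrix.add_apply, Matrix.smul_apply, eMat, Matrix.diagonal_mul, smul_eq_mul]
  by_cases hab : f (lo i) = f (hi i)
  · rw [comp_sTr_of_eq hab, hab, brCoeff_self, if_pos rfl]
    linear_combination X f f' * hv'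
  · by_cases hc : (f (lo i)).1 = (f (hi i)).1
    · have h1 : brCoeff v (f (lo i)) (f (hi i)) + brCoeff v (f (hi i)) (f (lo i)) = v - v⁻¹ := by
        have := vec_ne hab hc
        simp only [brCoeff]
        split_ifs <;> first | (exfalso; grind) | ring
      rw [if_pos hc]
      linear_combination X (f ∘ sTr i) f' * h1 + X f f' * brCoeff_sq (v := v) hab
    · rw [if_neg hc]
      have h1 : brCoeff v (f (lo i)) (f (hi i)) = 0 := if_neg hc
      have h2 : brCoeff v (f (hi i)) (f (lo i)) = 0 := if_neg (Ne.symm hc)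
      rw [h1, h2]
      ring

theorem eMat_comm (i : Fin (n - 1)) : eMat N i * sigMat v N i = sigMat v N i * eMat N i := by
  rw [← mul_one (eMat N i * sigMat v N i), ← mul_one (sigMat v N i * eMat N i)]
  generalize (1 : Mat N n) = X
  ext f f'
  simp only [mul_assoc, sigMat_mul, Function.comp_apply, sTr_lo, sTr_hi, eMat,
    Matrix.diagonal_mul]
  by_cases hc : (f (lo i)).1 = (f (hi i)).1
  · rw [if_pos hc, if_pos hc.symm]; ring
  · rw [if_neg hc, if_neg (Ne.symm hc)]; ring

/-- The braiding generators as invertible matrices. -/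
def sigUnit (hv : v ≠ 0) (N : ZMod d → ℕ) (i : Fin (n - 1)) : (Mat N n)ˣ where
  val := sigMat v N i
  inv := sigMat v N i - (v - v⁻¹) • eMat N i
  val_inv := by
    rw [mul_sub, sigMat_mul_self v hv, mul_smul_comm, eMat_comm]; abel
  inv_val := by
    rw [sub_mul, sigMat_mul_self v hv, smul_mul_assoc]; abel

/-- The framing generators as invertible matrices. -/
def tUnit (N : ZMod d → ℕ) (j : Fin n) : (Mat N n)ˣ where
  val := tMat N j
  inv := Matrix.diagonal fun f => ZMod.stdAddChar (-(f j).1)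
  val_inv := by
    rw [tMat, Matrix.diagonal_mul_diagonal, ← Matrix.diagonal_one]
    congr 1; funext f
    rw [← AddChar.map_add_eq_mul, add_neg_cancel, AddChar.map_zero_eq_one]
  inv_val := by
    rw [tMat, Matrix.diagonal_mul_diagonal, ← Matrix.diagonal_one]
    congr 1; funext f
    rw [← AddChar.map_add_eq_mul, neg_add_cancel, AddChar.map_zero_eq_one]

/-- The diagonal coefficients vanish between different colours, and where they do not vanish the two
framings act by the same scalar. -/
theorem tMat_mul_sigMat (i : Fin (n - 1)) (j : Fin n) :
    tMat N j * sigMat v N i = sigMat v N i * tMat N (sTr i j) := by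
  rw [← mul_one (tMat N j * sigMat v N i), ← mul_one (sigMat v N i * tMat N (sTr i j))]
  generalize (1 : Mat N n) = X
  ext f f'
  simp only [mul_assoc, sigMat_mul, Function.comp_apply, tMat, Matrix.diagonal_mul, sTr_sTr]
  by_cases hc : (f (lo i)).1 = (f (hi i)).1
  · have : (f (sTr i j)).1 = (f j).1 :=
      congrFun (comp_sTr_of_eq (i := i) (f := fun k => (f k).1) hc) j
    rw [this]; ring
  · have h1 : brCoeff v (f (lo i)) (f (hi i)) = 0 := if_neg hc
    rw [h1]; ring

theorem tMat_pow (j : Fin n) (s : ℕ) :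
    tMat N j ^ s = Matrix.diagonal fun f => ZMod.stdAddChar ((s : ZMod d) * (f j).1) := by
  rw [tMat, Matrix.diagonal_pow]
  congr 1; funext f
  rw [Pi.pow_apply, ← AddChar.map_nsmul_eq_pow, nsmul_eq_mul]

/-- The representation of the framed braid group on the `n`-th tensor power. -/
def rep (hv : v ≠ 0) (N : ZMod d → ℕ) (n : ℕ) : FramedBraidGroup d n →* (Mat N n)ˣ :=
  PresentedGroup.toGroup (f := Sum.elim (fun i => sigUnit v hv N i) (fun j => tUnit N j)) (by
    rintro w (⟨i, j, h⟩ | ⟨i, j, h⟩ | ⟨i, j⟩ | ⟨i, j⟩ | ⟨j⟩) <;>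
      simp only [fσ, ft, map_mul, map_inv, map_pow, FreeGroup.lift_apply_of, Sum.elim_inl,
        Sum.elim_inr, mul_inv_eq_one] <;> refine Units.ext ?_
    · exact sigMat_braid v hv i j h
    · exact sigMat_comm v i j h
    · change tMat N i * tMat N j = tMat N j * tMat N i
      rw [tMat, tMat, Matrix.diagonal_mul_diagonal, Matrix.diagonal_mul_diagonal]
      simp only [mul_comm]
    · exact tMat_mul_sigMat v i j
    · change tMat N j ^ d = 1
      rw [tMat_pow, ← Matrix.diagonal_one]
      simp)

theorem rep_σF (hv : v ≠ 0) (i : Fin (n - 1)) :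
    (rep v hv N n (σF d i) : Mat N n) = sigMat v N i :=
  congrArg Units.val (PresentedGroup.toGroup.of _)

theorem rep_tF (hv : v ≠ 0) (j : Fin n) : (rep v hv N n (tF d j) : Mat N n) = tMat N j :=
  congrArg Units.val (PresentedGroup.toGroup.of _)

theorem rep_tF_inv (hv : v ≠ 0) (j : Fin n) : (rep v hv N n (tF d j)⁻¹ : Mat N n) =
    Matrix.diagonal fun f => ZMod.stdAddChar (-(f j).1) := by
  rw [map_inv]
  exact congrArg (fun u : (Mat N n)ˣ => (u⁻¹).val) (PresentedGroup.toGroup.of _)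

theorem sum_stdAddChar (k : ZMod d) :
    ∑ s : ZMod d, ZMod.stdAddChar (s * k) = if k = 0 then (d : ℂ) else 0 := by
  rw [AddChar.sum_mulShift k (ZMod.isPrimitive_stdAddChar d), ZMod.card]
  simp

theorem sum_stdAddChar_neg (s : ZMod d) :
    ∑ k : ZMod d, (ZMod.stdAddChar (-(s * k)) : ℂ) = if s = 0 then (d : ℂ) else 0 := by
  have := sum_stdAddChar (-s)
  simp only [neg_eq_zero] at this
  rw [← this]
  refine Finset.sum_congr rfl fun k _ => ?_
  congr 1; ring

theorem sum_Icc_natCast {M : Type*} [AddCommMonoid M] (φ : ZMod d → M) :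
    ∑ s ∈ Finset.Icc 1 d, φ (s : ZMod d) = ∑ s : ZMod d, φ s := by
  have hd : 0 < d := NeZero.pos d
  refine Finset.sum_bij (fun s _ => (s : ZMod d)) (fun _ _ => Finset.mem_univ _) ?_ ?_
    (fun _ _ => rfl)
  · intro a ha b hb hab
    rw [Finset.mem_Icc] at ha hb
    have := (ZMod.natCast_eq_natCast_iff' a b d).1 hab
    rcases ha.2.lt_or_eq with h | h <;> rcases hb.2.lt_or_eq with h' | h'
    · rwa [Nat.mod_eq_of_lt h, Nat.mod_eq_of_lt h'] at this
    · rw [Nat.mod_eq_of_lt h, h', Nat.mod_self] at this; omega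
    · rw [Nat.mod_eq_of_lt h', h, Nat.mod_self] at this; omega
    · omega
  · intro k _
    rcases eq_or_ne k 0 with rfl | hk
    · exact ⟨d, Finset.mem_Icc.2 ⟨hd, le_rfl⟩, by simp⟩
    · refine ⟨k.val, Finset.mem_Icc.2 ⟨?_, (ZMod.val_lt k).le⟩, by simp⟩
      have : k.val ≠ 0 := by rwa [Ne, ZMod.val_eq_zero]
      omega

/-- Character orthogonality: the sum over `s` detects equality of the two colours. The factor `d`
stays because the sum is not normalized. -/
theorem sum_rep_tF (hv : v ≠ 0) (i : Fin (n - 1)) :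
    ∑ s ∈ Finset.Icc 1 d, (rep v hv N n (tF d (lo i) ^ s * (tF d (hi i) ^ s)⁻¹) : Mat N n) =
      (d : ℂ) • eMat N i := by
  have : ∀ s : ℕ, (rep v hv N n (tF d (lo i) ^ s * (tF d (hi i) ^ s)⁻¹) : Mat N n) =
      Matrix.diagonal fun f =>
        ZMod.stdAddChar ((s : ZMod d) * ((f (lo i)).1 - (f (hi i)).1)) := by
    intro s
    rw [← inv_pow, map_mul, map_pow, map_pow, Units.val_mul, Units.val_pow_eq_pow_val,
      Units.val_pow_eq_pow_val, rep_tF, rep_tF_inv, tMat_pow, Matrix.diagonal_pow,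
      Matrix.diagonal_mul_diagonal]
    congr 1; funext f
    rw [Pi.pow_apply, ← AddChar.map_nsmul_eq_pow, nsmul_eq_mul, ← AddChar.map_add_eq_mul]
    congr 1; ring
  simp only [this]
  rw [sum_Icc_natCast (fun s : ZMod d => (Matrix.diagonal fun f : Fin n → Vec N =>
    (ZMod.stdAddChar (s * ((f (lo i)).1 - (f (hi i)).1)) : ℂ)))]
  ext f f'
  rw [Matrix.sum_apply]
  by_cases hf : f = f'
  · subst hf
    simp only [Matrix.diagonal_apply_eq, Matrix.smul_apply, eMat, sum_stdAddChar, sub_eq_zero,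
      smul_eq_mul]
    split_ifs <;> simp
  · simp [eMat, Matrix.diagonal_apply_ne _ hf]

end Rep

/-! ### The weighted trace -/

section WeightedTrace

variable {d : ℕ} {N : ZMod d → ℕ} {n : ℕ} (v z : ℂ)

/-- The weight of a basis vector. -/
def wt (a : Vec N) : ℂ := z * v⁻¹ * (v⁻¹ ^ 2) ^ a.2.1

/-- The sum of the weights of the first `m` vectors of a colour. -/
def wtSum (m : ℕ) : ℂ := ∑ r ∈ Finset.range m, z * v⁻¹ * (v⁻¹ ^ 2) ^ r

/-- A geometric series, with the denominator cleared so that `v² = 1` needs no separate treatment.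
-/
theorem wtSum_eq (hv : v ≠ 0) (m : ℕ) : (v - v⁻¹) * wtSum v z m = z * (1 - (v⁻¹ ^ 2) ^ m) := by
  have hv' : v * v⁻¹ = 1 := mul_inv_cancel₀ hv
  induction m with
  | zero => simp [wtSum]
  | succ m ih =>
    rw [wtSum, Finset.sum_range_succ, ← wtSum, mul_add, ih]
    linear_combination hv' * (z * (v⁻¹ ^ 2) ^ m)

/-- The weight of a basis tensor. -/
def wtTensor (f : Fin n → Vec N) : ℂ := ∏ j, wt v z (f j)

theorem wtTensor_snoc (f : Fin n → Vec N) (a : Vec N) :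
    wtTensor v z (Fin.snoc (α := fun _ => Vec N) f a) = wtTensor v z f * wt v z a := by
  simp [wtTensor, Fin.prod_univ_castSucc]

/-- The matrix acting on the first `n` of `n + 1` tensor factors. -/
def inclMatFun (M : Mat N n) : Mat N (n + 1) := Matrix.of fun f f' =>
  if f (Fin.last n) = f' (Fin.last n) then M (Fin.init f) (Fin.init f') else 0

theorem inclMatFun_apply (M : Mat N n) (f f' : Fin (n + 1) → Vec N) : inclMatFun M f f' =
    if f (Fin.last n) = f' (Fin.last n) then M (Fin.init f) (Fin.init f') else 0 := rfl

variable [NeZero d]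

theorem sum_wt (φ : ZMod d → ℂ) :
    ∑ a : Vec N, wt v z a * φ a.1 = ∑ k, wtSum v z (N k) * φ k := by
  rw [Fintype.sum_sigma]
  refine Finset.sum_congr rfl fun k _ => ?_
  rw [wtSum, ← Fin.sum_univ_eq_sum_range, Finset.sum_mul]
  rfl

/-- This partial trace of the braiding dictates the weights. If `a` has index `i` in its colour, the
earlier vectors contribute `z (1 - v^(-2i))`, `a` itself contributes `z v^(-2i)`, and later vectors
nothing. The total depends neither on `a` nor on `N`. -/
theorem sum_wt_brCoeff (hv : v ≠ 0) (a : Vec N) :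
    ∑ b : Vec N, wt v z b * (brCoeff v a b + if a = b then 1 else 0) = z := by
  obtain ⟨k, i⟩ := a
  rw [Fintype.sum_sigma, Finset.sum_eq_single k]
  · have h1 : ∀ j : Fin (N k), wt v z (⟨k, j⟩ : Vec N) * (brCoeff v (⟨k, i⟩ : Vec N) ⟨k, j⟩ +
        if (⟨k, i⟩ : Vec N) = ⟨k, j⟩ then 1 else 0) =
        (fun r : ℕ => z * v⁻¹ * (v⁻¹ ^ 2) ^ r *
          (if r < i.1 then v - v⁻¹ else if r = i.1 then v else 0)) j.1 := by
      intro j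
      rcases lt_trichotomy j.1 i.1 with h | h | h
      · have : i ≠ j := fun e => by simp [e] at h
        simp [wt, brCoeff, h, this]
      · have : i = j := Fin.ext h.symm
        subst this
        simp [wt, brCoeff]
      · have : i ≠ j := fun e => by simp [e] at h
        simp [wt, brCoeff, h.not_gt, this, h.ne, h.ne']
    rw [Finset.sum_congr rfl fun j _ => h1 j, Fin.sum_univ_eq_sum_range (fun r : ℕ =>
      z * v⁻¹ * (v⁻¹ ^ 2) ^ r * (if r < i.1 then v - v⁻¹ else if r = i.1 then v else 0)),
      ← Finset.sum_range_add_sum_Ico _ (Nat.succ_le_of_lt i.2), Finset.sum_range_succ,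
      Finset.sum_congr rfl (g := fun r => z * v⁻¹ * (v⁻¹ ^ 2) ^ r * (v - v⁻¹))
        (fun r hr => by rw [if_pos (Finset.mem_range.1 hr)]),
      Finset.sum_eq_zero (s := Finset.Ico _ _), ← Finset.sum_mul, ← wtSum, if_neg (lt_irrefl _),
      if_pos rfl, mul_comm, wtSum_eq v z hv]
    · have hv' : v * v⁻¹ = 1 := mul_inv_cancel₀ hv
      linear_combination z * (v⁻¹ ^ 2) ^ i.1 * hv'
    · intro r hr
      rw [Finset.mem_Ico] at hr
      rw [if_neg (by omega), if_neg (by omega), mul_zero]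
  · intro l _ hl
    refine Finset.sum_eq_zero fun j _ => ?_
    have : (⟨k, i⟩ : Vec N) ≠ ⟨l, j⟩ := fun e => hl (congrArg Sigma.fst e).symm
    simp [brCoeff, hl.symm, this]
  · simp

/-- The weighted trace. -/
def wtTrace (M : Mat N n) : ℂ := ∑ f, wtTensor v z f * M f f

theorem wtTrace_eq (M : Mat N n) :
    wtTrace v z M = (Matrix.diagonal (wtTensor v z) * M).trace := by
  simp [wtTrace, Matrix.trace]

theorem wtTrace_add (M M' : Mat N n) :
    wtTrace v z (M + M') = wtTrace v z M + wtTrace v z M' := by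
  simp [wtTrace, mul_add, Finset.sum_add_distrib]

theorem wtTrace_smul (c : ℂ) (M : Mat N n) : wtTrace v z (c • M) = c * wtTrace v z M := by
  simp [wtTrace, Finset.mul_sum, mul_left_comm]

theorem wtTensor_commute_sigMat (i : Fin (n - 1)) :
    Commute (Matrix.diagonal (wtTensor v z)) (sigMat v N i) := by
  rw [Commute, SemiconjBy, ← mul_one (_ * sigMat v N i), ← mul_one (sigMat v N i * _)]
  generalize (1 : Mat N n) = X
  ext f f'
  have : wtTensor v z (f ∘ sTr i) = wtTensor v z f := Equiv.prod_comp (sTr i) fun j => wt v z (f j)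
  simp only [mul_assoc, sigMat_mul, Matrix.diagonal_mul, this]
  ring

theorem wtTensor_commute_rep (hv : v ≠ 0) (w : FramedBraidGroup d n) :
    Commute (Matrix.diagonal (wtTensor v z)) (rep v hv N n w : Mat N n) := by
  let H : Subgroup (FramedBraidGroup d n) :=
    { carrier := {w | Commute (Matrix.diagonal (wtTensor v z)) (rep v hv N n w : Mat N n)}
      mul_mem' := fun {a b} ha hb => by
        have : Commute _ _ := ha.mul_right hb
        rwa [← Units.val_mul, ← map_mul] at this
      one_mem' := by simp
      inv_mem' := fun {a} ha => by
        have := Commute.units_inv_right ha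
        rwa [← map_inv] at this }
  refine framed_generated d n H (fun i => ?_) (fun j => ?_) w
  · change Commute _ _
    rw [rep_σF]; exact wtTensor_commute_sigMat v z i
  · change Commute _ _
    rw [rep_tF, tMat, Commute, SemiconjBy, Matrix.diagonal_mul_diagonal,
      Matrix.diagonal_mul_diagonal]
    simp only [mul_comm]

/-- The weighted trace is the trace against a diagonal weight matrix that commutes with the image of
the framed braid group; for this reason one factor is taken from that image. -/
theorem wtTrace_mul_comm (hv : v ≠ 0) (M : Mat N n) (w : FramedBraidGroup d n) :
    wtTrace v z (M * (rep v hv N n w : Mat N n)) =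
      wtTrace v z ((rep v hv N n w : Mat N n) * M) := by
  rw [wtTrace_eq, wtTrace_eq, ← mul_assoc, Matrix.trace_mul_comm, ← mul_assoc, ← mul_assoc,
    (wtTensor_commute_rep v z hv w).eq]

theorem sum_snoc {V M : Type*} [Fintype V] [AddCommMonoid M] (F : (Fin (n + 1) → V) → M) :
    ∑ f, F f = ∑ f : Fin n → V, ∑ a, F (Fin.snoc (α := fun _ => V) f a) := by
  rw [← Fintype.sum_prod_type', ← (Equiv.prodComm _ _).sum_comp,
    ← (Fin.snocEquiv fun _ => V).sum_comp]
  rfl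

theorem eq_iff_init_last {V : Type*} {f g : Fin (n + 1) → V} :
    f = g ↔ f (Fin.last n) = g (Fin.last n) ∧
      (Fin.init f : Fin n → V) = (Fin.init g : Fin n → V) := by
  refine ⟨fun h => h ▸ ⟨rfl, rfl⟩, fun ⟨h, h'⟩ => ?_⟩
  rw [← Fin.snoc_init_self f, ← Fin.snoc_init_self g, h, h']

theorem inclMatFun_mul (M M' : Mat N n) :
    inclMatFun (M * M') = inclMatFun M * inclMatFun M' := by
  ext f f'
  rw [inclMatFun_apply, Matrix.mul_apply (M := inclMatFun M), sum_snoc]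
  simp only [inclMatFun_apply, Fin.snoc_last, Fin.init_snoc]
  have h (g : Fin n → Vec N) : ∑ a, (if f (Fin.last n) = a then M (Fin.init f) g else 0) *
      (if a = f' (Fin.last n) then M' g (Fin.init f') else 0) =
      if f (Fin.last n) = f' (Fin.last n) then M (Fin.init f) g * M' g (Fin.init f') else 0 := by
    rw [Finset.sum_eq_single (f (Fin.last n)) (fun b _ hb => by rw [if_neg hb.symm, zero_mul])
      (fun h => absurd (Finset.mem_univ _) h), if_pos rfl, mul_ite, mul_zero]
  simp only [h]
  split_ifs
  · rw [Matrix.mul_apply]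
  · simp

theorem inclMatFun_algebraMap (c : ℂ) :
    inclMatFun (algebraMap ℂ (Mat N n) c) = algebraMap ℂ (Mat N (n + 1)) c := by
  ext f f'
  simp only [inclMatFun_apply, Matrix.algebraMap_matrix_apply, eq_iff_init_last (f := f)]
  by_cases h : f (Fin.last n) = f' (Fin.last n) <;> simp [h]

/-- The inclusion of matrix algebras. -/
def inclMat (N : ZMod d → ℕ) (n : ℕ) : Mat N n →ₐ[ℂ] Mat N (n + 1) where
  toFun := inclMatFun
  map_one' := by simpa using inclMatFun_algebraMap (N := N) (n := n) 1
  map_mul' := inclMatFun_mul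
  map_zero' := by simpa using inclMatFun_algebraMap (N := N) (n := n) 0
  map_add' M M' := by
    ext f f'
    simp only [Matrix.add_apply, inclMatFun_apply]
    split_ifs <;> simp
  commutes' := inclMatFun_algebraMap

theorem inclMat_apply (M : Mat N n) (f f' : Fin (n + 1) → Vec N) : inclMat N n M f f' =
    if f (Fin.last n) = f' (Fin.last n) then M (Fin.init f) (Fin.init f') else 0 := rfl

theorem sTr_up_last (i : Fin (n - 1)) : sTr (up i) (Fin.last n) = Fin.last n :=
  sTr_of_ne (by simp [lo, up, Fin.ext_iff]; omega) (by simp [hi, up, Fin.ext_iff]; omega)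

theorem inclMat_sigMat (i : Fin (n - 1)) :
    inclMat N n (sigMat v N i) = sigMat v N (n := n + 1) (up i) := by
  ext f f'
  have h1 : (Fin.init (f ∘ sTr (up i)) : Fin n → Vec N) = Fin.init f ∘ sTr i := by
    funext j
    simp only [Fin.init, Function.comp_apply, sTr_up]
  rw [inclMat_apply]
  simp only [sigMat, eq_iff_init_last (n := n) (f := f),
    eq_iff_init_last (n := n) (f := f ∘ sTr (up i)), h1, Function.comp_apply, sTr_up_last]
  by_cases h : f (Fin.last n) = f' (Fin.last n)
  · simp only [h, if_true, true_and]; rfl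
  · simp [h]

theorem inclMat_tMat (j : Fin n) : inclMat N n (tMat N j) = tMat N j.castSucc := by
  ext f f'
  rw [inclMat_apply]
  simp only [tMat, Matrix.diagonal_apply, eq_iff_init_last (n := n) (f := f)]
  by_cases h : f (Fin.last n) = f' (Fin.last n)
  · simp only [h, if_true, true_and]; rfl
  · simp [h]

theorem inclMat_rep (hv : v ≠ 0) (w : FramedBraidGroup d n) :
    inclMat N n (rep v hv N n w : Mat N n) =
      (rep v hv N (n + 1) (inclF d n w) : Mat N (n + 1)) := by
  have : (Units.map (inclMat N n : Mat N n →* Mat N (n + 1))).comp (rep v hv N n) =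
      (rep v hv N (n + 1)).comp (inclF d n) := by
    refine PresentedGroup.ext ?_
    rintro (i | j) <;> refine Units.ext ?_
    · change inclMat N n (rep v hv N n (σF d i) : Mat N n) =
        (rep v hv N (n + 1) (inclF d n (σF d i)) : Mat N (n + 1))
      rw [inclF_σF, rep_σF, rep_σF, inclMat_sigMat]
    · change inclMat N n (rep v hv N n (tF d j) : Mat N n) =
        (rep v hv N (n + 1) (inclF d n (tF d j)) : Mat N (n + 1))
      rw [inclF_tF, rep_tF, rep_tF, inclMat_tMat]
  exact congrArg Units.val (DFunLike.congr_fun this w)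

/-- The last tensor factor splits off, and its weights are collected by colour. -/
theorem wtTrace_incl_t (M : Mat N n) (s : ℕ) :
    wtTrace v z (inclMat N n M * tMat N (Fin.last n) ^ s) =
      (∑ k, wtSum v z (N k) * ZMod.stdAddChar ((s : ZMod d) * k)) * wtTrace v z M := by
  rw [← sum_wt v z (fun k => ZMod.stdAddChar ((s : ZMod d) * k)), wtTrace, sum_snoc, wtTrace,
    Finset.mul_sum]
  refine Finset.sum_congr rfl fun f _ => ?_
  rw [Finset.sum_mul]
  refine Finset.sum_congr rfl fun a _ => ?_
  rw [tMat_pow, Matrix.mul_diagonal, inclMat_apply, if_pos rfl, wtTensor_snoc, Fin.snoc_last,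
    Fin.init_snoc]
  ring

theorem mul_sigMat (i : Fin (n - 1)) (X : Mat N n) (f f' : Fin n → Vec N) :
    (X * sigMat v N i) f f' =
      X f f' * brCoeff v (f' (lo i)) (f' (hi i)) + X f (f' ∘ sTr i) := by
  have : ∀ g : Fin n → Vec N, g ∘ sTr i = f' ↔ g = f' ∘ sTr i := fun g =>
    ⟨fun h => by rw [← h, comp_sTr_sTr], fun h => by rw [h, comp_sTr_sTr]⟩
  simp [Matrix.mul_apply, sigMat, mul_add, Finset.sum_add_distrib, this]

/-- Summing over the last tensor factor first leaves the partial trace of the braiding, which is the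
scalar `z` by `sum_wt_brCoeff`. The flip contributes only when the last two labels agree. -/
theorem wtTrace_incl_g (hv : v ≠ 0) (M : Mat N (n + 1)) :
    wtTrace v z (inclMat N (n + 1) M * sigMat v N (n := n + 2) (top n)) =
      z * wtTrace v z M := by
  rw [wtTrace, sum_snoc, wtTrace, Finset.mul_sum]
  refine Finset.sum_congr rfl fun f _ => ?_
  trans (∑ b : Vec N, wt v z b * (brCoeff v (f (Fin.last n)) b +
    if f (Fin.last n) = b then 1 else 0)) * (wtTensor v z f * M f f)
  swap
  · rw [sum_wt_brCoeff v z hv]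
  rw [Finset.sum_mul]
  refine Finset.sum_congr rfl fun a _ => ?_
  have h0 : (Fin.snoc (α := fun _ => Vec N) f a) (lo (n := n + 2) (top n)) = f (Fin.last n) := by
    rw [lo_top]; exact Fin.snoc_castSucc (α := fun _ => Vec N) _ _ _
  have h1 : (Fin.snoc (α := fun _ => Vec N) f a) (hi (n := n + 2) (top n)) = a := by
    rw [hi_top]; exact Fin.snoc_last (α := fun _ => Vec N) _ _
  have h2 : (Fin.snoc (α := fun _ => Vec N) f a ∘ sTr (n := n + 2) (top n)) (Fin.last (n + 1)) =
      f (Fin.last n) := by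
    rw [Function.comp_apply, ← hi_top, sTr_hi, h0]
  rw [mul_sigMat, inclMat_apply, inclMat_apply, if_pos rfl, wtTensor_snoc, h0, h1, h2,
    Fin.snoc_last, Fin.init_snoc]
  by_cases h : f (Fin.last n) = a
  · have h3 : Fin.snoc (α := fun _ => Vec N) f a ∘ sTr (n := n + 2) (top n) =
        Fin.snoc (α := fun _ => Vec N) f a := comp_sTr_of_eq (by rw [h0, h1, h])
    rw [h3, Fin.init_snoc, if_pos h, if_pos h.symm]
    ring
  · rw [if_neg h, if_neg (Ne.symm h)]
    ring

end WeightedTrace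

/-! ### Generic parameters -/

/-- The parameters of a tensor representation with a weighted trace. -/
structure Param (d : ℕ) where
  /-- The eigenvalue of the braiding. -/
  v : ℂ
  hv : v ≠ 0
  /-- The Markov parameter. -/
  z : ℂ
  /-- The number of basis vectors of each colour. -/
  N : ZMod d → ℕ

/-- The ring of generic parameters: `none` stands for `q - q⁻¹`, `some none` for `z` and
`some (some k)` for the total weight of the colour `k`. -/
abbrev GenRing (d : ℕ) : Type := MvPolynomial (Option (Option (ZMod d))) ℂ

/-- The values of the generic parameters. -/
def Param.val {d : ℕ} (p : Param d) : Option (Option (ZMod d)) → ℂ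
  | none => p.v - p.v⁻¹
  | some none => p.z
  | some (some k) => wtSum p.v p.z (p.N k)

/-- An integer `v ≥ 2` has distinct powers, so the total weight of a colour takes infinitely many
values as the number of vectors varies. -/
theorem wtSum_injective {m : ℕ} {z : ℂ} (hz : z ≠ 0) :
    Function.Injective (wtSum ((m + 2 : ℕ) : ℂ) z) := by
  intro a b hab
  have hv : ((m + 2 : ℕ) : ℂ) ≠ 0 := Nat.cast_ne_zero.2 (by omega)
  have h := wtSum_eq _ z hv a
  rw [hab, wtSum_eq _ z hv b] at h
  have h1 := mul_left_cancel₀ hz h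
  have h2 : (((m + 2 : ℕ) : ℂ) ^ 2) ^ a = (((m + 2 : ℕ) : ℂ) ^ 2) ^ b := by
    rw [← inv_inj, ← inv_pow, ← inv_pow, ← inv_pow, ← inv_pow]
    linear_combination h1
  have h3 : ((m + 2) ^ 2) ^ a = ((m + 2) ^ 2) ^ b := by exact_mod_cast h2
  exact Nat.pow_right_injective (show 2 ≤ (m + 2) ^ 2 by nlinarith [Nat.zero_le m]) h3

theorem sub_inv_injective :
    Function.Injective fun m : ℕ => ((m + 2 : ℕ) : ℂ) - ((m + 2 : ℕ) : ℂ)⁻¹ := by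
  intro a b hab
  have ha : ((a + 2 : ℕ) : ℂ) ≠ 0 := Nat.cast_ne_zero.2 (by omega)
  have hb : ((b + 2 : ℕ) : ℂ) ≠ 0 := Nat.cast_ne_zero.2 (by omega)
  have h : (((a + 2 : ℕ) : ℂ) - ((b + 2 : ℕ) : ℂ)) *
      (((a + 2 : ℕ) : ℂ) * ((b + 2 : ℕ) : ℂ) + 1) = 0 := by
    simp only at hab
    field_simp at hab
    linear_combination hab
  rcases mul_eq_zero.1 h with h | h
  · have : a + 2 = b + 2 := by exact_mod_cast sub_eq_zero.1 h
    omega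
  · exact absurd h (by norm_cast)

/-- The values of the generic parameters are Zariski dense. -/
theorem eq_of_eval_val {d : ℕ} [NeZero d] {P Q : GenRing d}
    (h : ∀ p : Param d, MvPolynomial.eval p.val P = MvPolynomial.eval p.val Q) : P = Q := by
  -- The attainable colour weights depend on `v` and `z`, so the parameter points do not form a
  -- product. With `v = m + 2` and `z ≠ 0` fixed, density in the colour weights comes first; `v` and
  -- `z` vary afterwards.
  have key : ∀ (m : ℕ) (z : ℂ), z ≠ 0 → ∀ y : ZMod d → ℂ,
      let x : Option (Option (ZMod d)) → ℂ := fun o =>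
        o.elim (((m + 2 : ℕ) : ℂ) - ((m + 2 : ℕ) : ℂ)⁻¹) (fun o' => o'.elim z y)
      MvPolynomial.eval x P = MvPolynomial.eval x Q := by
    intro m z hz y x
    let F : GenRing d →ₐ[ℂ] MvPolynomial (ZMod d) ℂ := MvPolynomial.aeval fun o =>
      o.elim (MvPolynomial.C (((m + 2 : ℕ) : ℂ) - ((m + 2 : ℕ) : ℂ)⁻¹))
        (fun o' => o'.elim (MvPolynomial.C z) MvPolynomial.X)
    have hF : ∀ (y : ZMod d → ℂ) (R : GenRing d), MvPolynomial.eval y (F R) =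
        MvPolynomial.eval (fun o => o.elim (((m + 2 : ℕ) : ℂ) - ((m + 2 : ℕ) : ℂ)⁻¹)
          (fun o' => o'.elim z y)) R := by
      intro y R
      have : ((MvPolynomial.aeval y).comp F : GenRing d →ₐ[ℂ] ℂ) =
          MvPolynomial.aeval (fun o => o.elim (((m + 2 : ℕ) : ℂ) - ((m + 2 : ℕ) : ℂ)⁻¹)
            (fun o' => o'.elim z y)) := by
        refine MvPolynomial.algHom_ext fun o => ?_
        rcases o with _ | _ | k <;> simp [F]
      exact DFunLike.congr_fun this R
    have hFPQ : F P = F Q := by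
      refine MvPolynomial.funext_set (fun _ => Set.range (wtSum ((m + 2 : ℕ) : ℂ) z))
        (fun _ => Set.infinite_range_of_injective (wtSum_injective hz)) fun y hy => ?_
      choose N hN using fun k => hy k (Set.mem_univ k)
      have := h ⟨((m + 2 : ℕ) : ℂ), Nat.cast_ne_zero.2 (by omega), z, N⟩
      rw [hF, hF]
      have hN' : Param.val ⟨((m + 2 : ℕ) : ℂ), Nat.cast_ne_zero.2 (by omega), z, N⟩ =
          fun o => o.elim (((m + 2 : ℕ) : ℂ) - ((m + 2 : ℕ) : ℂ)⁻¹) (fun o' => o'.elim z y) := by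
        funext o
        rcases o with _ | _ | k
        · rfl
        · rfl
        · exact hN k
      rwa [hN'] at this
    have := hF y P
    rw [hFPQ, hF y Q] at this
    exact this.symm
  refine MvPolynomial.funext_set
    (fun o => o.elim (Set.range fun m : ℕ => ((m + 2 : ℕ) : ℂ) - ((m + 2 : ℕ) : ℂ)⁻¹)
      (fun o' => o'.elim {z | z ≠ 0} fun _ => Set.univ)) ?_ ?_
  · rintro (_ | _ | k)
    · exact Set.infinite_range_of_injective sub_inv_injective
    · exact (Set.finite_singleton (0 : ℂ)).infinite_compl
    · exact Set.infinite_univ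
  · intro x hx
    obtain ⟨m, hm⟩ := hx none (Set.mem_univ _)
    have hz : x (some none) ≠ 0 := hx (some none) (Set.mem_univ _)
    have := key m (x (some none)) hz (fun k => x (some (some k)))
    have hx' : (fun o => o.elim (((m + 2 : ℕ) : ℂ) - ((m + 2 : ℕ) : ℂ)⁻¹)
        (fun o' => o'.elim (x (some none)) fun k => x (some (some k)))) = x := by
      funext o
      rcases o with _ | _ | k
      · exact hm
      · rfl
      · rfl
    rwa [hx'] at this

/-! ### The weighted traces are polynomial in the parameters -/

theorem framed_zero_eq_one (d : ℕ) (w : FramedBraidGroup d 0) : w = 1 :=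
  framed_generated d 0 ⊥ (fun i => absurd i.2 (by omega)) (fun j => j.elim0) w

section Generic

variable (d : ℕ) [NeZero d]

/-- The matrices acting on the `n`-th tensor power, for all values of the parameters. -/
def Mats (n : ℕ) : Type := ∀ p : Param d, Mat p.N n

instance (n : ℕ) : Ring (Mats d n) := inferInstanceAs (Ring (∀ p : Param d, Mat p.N n))

/-- Evaluation of the generic parameters, as scalar matrices. -/
def scalarMats (n : ℕ) : GenRing d →+* Mats d n :=
  RingHom.pi fun p => (algebraMap ℂ (Mat p.N n)).comp (MvPolynomial.eval p.val)

/-- A polynomial acts on each component by its value at that component's parameters. A spanning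
statement over `GenRing d` then says that the coefficients depend polynomially on the parameters. -/
instance (n : ℕ) : Algebra (GenRing d) (Mats d n) where
  smul P M := fun p => MvPolynomial.eval p.val P • M p
  algebraMap := scalarMats d n
  commutes' P M := funext fun p => Algebra.commutes (MvPolynomial.eval p.val P) (M p)
  smul_def' P M := funext fun p => Algebra.smul_def (MvPolynomial.eval p.val P) (M p)

variable {d}

theorem Mats.smul_apply {n : ℕ} (P : GenRing d) (M : Mats d n) (p : Param d) :
    (P • M) p = MvPolynomial.eval p.val P • M p := rfl

theorem Mats.sum_apply {n : ℕ} {β : Type*} (s : Finset β) (M : β → Mats d n) (p : Param d) :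
    (∑ b ∈ s, M b) p = ∑ b ∈ s, M b p :=
  Finset.sum_apply (M := fun p : Param d => Mat p.N n) p s M

variable (d)

/-- The tensor representations for all values of the parameters. -/
def matsRep (n : ℕ) : FramedBraidGroup d n →* Mats d n where
  toFun w := fun p => (rep p.v p.hv p.N n w : Mat p.N n)
  map_one' := by funext p; rw [map_one]; rfl
  map_mul' a b := by funext p; rw [map_mul]; rfl

theorem matsRep_quad (n : ℕ) (i : Fin (n - 1)) : matsRep d n (σF d i) * matsRep d n (σF d i) =
    1 + (MvPolynomial.C (1 / (d : ℂ)) * MvPolynomial.X none : GenRing d) •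
      ((∑ s ∈ Finset.Icc 1 d, matsRep d n (tF d (lo i) ^ s * (tF d (hi i) ^ s)⁻¹)) *
        matsRep d n (σF d i)) := by
  funext p
  have hd : (d : ℂ) ≠ 0 := NeZero.ne _
  have hs : (∑ s ∈ Finset.Icc 1 d, matsRep d n (tF d (lo i) ^ s * (tF d (hi i) ^ s)⁻¹)) p =
      (d : ℂ) • eMat p.N i := by
    rw [← sum_rep_tF p.v p.hv, Mats.sum_apply]
    rfl
  have hσ : matsRep d n (σF d i) p = sigMat p.v p.N i := rep_σF p.v p.hv i
  change matsRep d n (σF d i) p * matsRep d n (σF d i) p =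
    1 + MvPolynomial.eval p.val (MvPolynomial.C (1 / (d : ℂ)) * MvPolynomial.X none) •
      ((∑ s ∈ Finset.Icc 1 d, matsRep d n (tF d (lo i) ^ s * (tF d (hi i) ^ s)⁻¹)) p *
        matsRep d n (σF d i) p)
  rw [hs, hσ, sigMat_mul_self p.v p.hv, smul_mul_assoc, smul_smul, map_mul,
    MvPolynomial.eval_C, MvPolynomial.eval_X]
  congr 2
  rw [Param.val]
  field_simp

/-- The tower of tensor representations for all values of the parameters. -/
def repTower :
    Tower (GenRing d) d (MvPolynomial.C (1 / (d : ℂ)) * MvPolynomial.X none) (Mats d) where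
  ρ := matsRep d
  ι n :=
    { toFun := fun M p => inclMat p.N n (M p)
      map_one' := funext fun _ => map_one _
      map_mul' := fun _ _ => funext fun _ => map_mul _ _ _
      map_zero' := funext fun _ => map_zero _
      map_add' := fun _ _ => funext fun _ => map_add _ _ _
      commutes' := fun _ => funext fun p => (inclMat p.N n).commutes _ }
  ι_ρ _ w := funext fun p => inclMat_rep p.v p.hv w
  quad := matsRep_quad d

/-- The families of matrices whose weighted trace is a polynomial in the generic parameters. -/
def polyMats (n : ℕ) : Submodule (GenRing d) (Mats d n) where
  carrier := {M | ∃ P : GenRing d, ∀ p, wtTrace p.v p.z (M p) = MvPolynomial.eval p.val P}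
  zero_mem' := ⟨0, fun p => by
    change wtTrace p.v p.z 0 = _
    simp [wtTrace]⟩
  add_mem' := by
    rintro M M' ⟨P, hP⟩ ⟨P', hP'⟩
    refine ⟨P + P', fun p => ?_⟩
    rw [map_add, ← hP, ← hP', ← wtTrace_add]
    rfl
  smul_mem' := by
    rintro Q M ⟨P, hP⟩
    refine ⟨Q * P, fun p => ?_⟩
    rw [Mats.smul_apply, wtTrace_smul, map_mul, hP]

/-- It suffices to treat standard elements. There the Markov rules reduce the trace to one strand
fewer, at the cost of a factor that is itself a polynomial in the parameters. -/
theorem B_le_polyMats (n : ℕ) : (repTower d).B n ≤ polyMats d n := by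
  have hcomm : ∀ (n : ℕ) (a b : Mats d n), b ∈ (repTower d).B n → ∀ p : Param d,
      wtTrace p.v p.z (a p * b p) = wtTrace p.v p.z (b p * a p) := by
    intro n a b hb p
    induction hb using Submodule.span_induction with
    | mem x hx =>
      obtain ⟨w, rfl⟩ := hx
      exact wtTrace_mul_comm p.v p.z p.hv (a p) w
    | zero =>
      change wtTrace p.v p.z (a p * 0) = wtTrace p.v p.z (0 * a p)
      rw [mul_zero, zero_mul]
    | add x y _ _ hx hy =>
      change wtTrace p.v p.z (a p * (x p + y p)) = wtTrace p.v p.z ((x p + y p) * a p)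
      rw [mul_add, add_mul, wtTrace_add, wtTrace_add, hx, hy]
    | smul P x _ hx =>
      rw [Mats.smul_apply, mul_smul_comm, smul_mul_assoc, wtTrace_smul, wtTrace_smul, hx]
  induction n with
  | zero =>
    rw [Tower.B, Submodule.span_le]
    rintro _ ⟨w, rfl⟩
    rw [framed_zero_eq_one d w, map_one]
    refine ⟨1, fun p => ?_⟩
    change wtTrace p.v p.z 1 = _
    simp [wtTrace, wtTensor]
  | succ n ih =>
    have ht : ∀ a ∈ (repTower d).B n, ∀ s : ℕ, (repTower d).ι n a *
        (repTower d).ρ (n + 1) (tF d (Fin.last n)) ^ s ∈ polyMats d (n + 1) := by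
      intro a ha s
      obtain ⟨P, hP⟩ := ih ha
      refine ⟨(∑ k, MvPolynomial.X (some (some k)) *
        MvPolynomial.C (ZMod.stdAddChar ((s : ZMod d) * k))) * P, fun p => ?_⟩
      change wtTrace p.v p.z (inclMat p.N n (a p) *
        (rep p.v p.hv p.N (n + 1) (tF d (Fin.last n)) : Mat p.N (n + 1)) ^ s) = _
      rw [rep_tF, wtTrace_incl_t, hP]
      simp [Param.val]
    refine ((repTower d).B_le_span_std n).trans (Submodule.span_le.2 ?_)
    cases n with
    | zero =>
      rintro _ ⟨a, ha, s, rfl⟩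
      exact ht a ha s
    | succ n =>
      rintro _ (⟨a, ha, s, rfl⟩ | ⟨a, ha, b, hb, rfl⟩)
      · exact ht a ha s
      -- Cyclicity brings `b` to the front, so the trace of `a g b` is `z` times that of `b a`.
      · obtain ⟨P, hP⟩ := ih ((repTower d).mul_mem hb ha)
        refine ⟨MvPolynomial.X (some none) * P, fun p => ?_⟩
        rw [map_mul, MvPolynomial.eval_X, ← hP]
        have h1 := hcomm (n + 2) ((repTower d).ι (n + 1) a *
          (repTower d).ρ (n + 2) (σF d (top n))) _ ((repTower d).ι_mem hb) p
        refine h1.trans ?_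
        change wtTrace p.v p.z (inclMat p.N (n + 1) (b p) * (inclMat p.N (n + 1) (a p) *
          (rep p.v p.hv p.N (n + 2) (σF d (top n)) : Mat p.N (n + 2)))) =
          p.z * wtTrace p.v p.z (b p * a p)
        rw [← mul_assoc, ← map_mul, rep_σF, wtTrace_incl_g p.v p.z p.hv]

/-- The generic trace of a framed braid. -/
def genTrace {n : ℕ} (w : FramedBraidGroup d n) : GenRing d :=
  (B_le_polyMats d n ((repTower d).ρ_mem n w)).choose

variable {d}

theorem eval_genTrace {n : ℕ} (w : FramedBraidGroup d n) (p : Param d) :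
    MvPolynomial.eval p.val (genTrace d w) =
      wtTrace p.v p.z (rep p.v p.hv p.N n w : Mat p.N n) :=
  ((B_le_polyMats d n ((repTower d).ρ_mem n w)).choose_spec p).symm

/-- As for the other rules of `genTrace`, the identity holds in every tensor representation and
hence between polynomials, by `eq_of_eval_val`. -/
theorem genTrace_mul_comm {n : ℕ} (u w : FramedBraidGroup d n) :
    genTrace d (u * w) = genTrace d (w * u) := by
  refine eq_of_eval_val fun p => ?_
  rw [eval_genTrace, eval_genTrace, map_mul, map_mul, Units.val_mul, Units.val_mul,
    wtTrace_mul_comm p.v p.z p.hv]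

theorem genTrace_zero (w : FramedBraidGroup d 0) : genTrace d w = 1 := by
  refine eq_of_eval_val fun p => ?_
  rw [eval_genTrace, framed_zero_eq_one d w, map_one]
  simp [wtTrace, wtTensor]

theorem genTrace_incl_t {n : ℕ} (w : FramedBraidGroup d n) (s : ℕ) :
    genTrace d (inclF d n w * tF d (Fin.last n) ^ s) =
      (∑ k, MvPolynomial.X (some (some k)) *
        MvPolynomial.C (ZMod.stdAddChar ((s : ZMod d) * k))) * genTrace d w := by
  refine eq_of_eval_val fun p => ?_
  rw [eval_genTrace, map_mul, Units.val_mul, ← inclMat_rep, map_pow, Units.val_pow_eq_pow_val,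
    rep_tF, wtTrace_incl_t, map_mul, eval_genTrace]
  simp [Param.val]

theorem genTrace_incl_g {n : ℕ} (w : FramedBraidGroup d (n + 1)) :
    genTrace d (inclF d (n + 1) w * σF d (n := n + 2) (top n)) =
      MvPolynomial.X (some none) * genTrace d w := by
  refine eq_of_eval_val fun p => ?_
  rw [eval_genTrace, map_mul, Units.val_mul, ← inclMat_rep, rep_σF,
    wtTrace_incl_g p.v p.z p.hv, map_mul, eval_genTrace, MvPolynomial.eval_X]
  rfl

theorem wtTrace_sum {N : ZMod d → ℕ} {n : ℕ} {β : Type*} (v z : ℂ) (s : Finset β)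
    (M : β → Mat N n) : wtTrace v z (∑ b ∈ s, M b) = ∑ b ∈ s, wtTrace v z (M b) := by
  simp only [wtTrace, Matrix.sum_apply, Finset.mul_sum]
  exact Finset.sum_comm

/-- The relation is placed between arbitrary `u` and `w` because the specialized trace must vanish
on the two-sided ideal it generates. -/
theorem genTrace_quad {n : ℕ} (u w : FramedBraidGroup d n) (i : Fin (n - 1)) :
    genTrace d (u * σF d i ^ 2 * w) = genTrace d (u * w) +
      MvPolynomial.C (1 / (d : ℂ)) * MvPolynomial.X none * ∑ s ∈ Finset.Icc 1 d,
        genTrace d (u * (tF d (lo i) ^ s * (tF d (hi i) ^ s)⁻¹) * σF d i * w) := by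
  refine eq_of_eval_val fun p => ?_
  have hd : (d : ℂ) ≠ 0 := NeZero.ne _
  simp only [map_add, map_mul, map_sum, eval_genTrace, MvPolynomial.eval_C, MvPolynomial.eval_X,
    Units.val_mul, sq, rep_σF]
  rw [← wtTrace_sum]
  have h1 : ∑ s ∈ Finset.Icc 1 d, (rep p.v p.hv p.N n u : Mat p.N n) *
      ((rep p.v p.hv p.N n (tF d (lo i) ^ s) : Mat p.N n) *
        (rep p.v p.hv p.N n (tF d (hi i) ^ s)⁻¹ : Mat p.N n)) *
      sigMat p.v p.N i * (rep p.v p.hv p.N n w : Mat p.N n) =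
      (d : ℂ) • ((rep p.v p.hv p.N n u : Mat p.N n) * (eMat p.N i *
      sigMat p.v p.N i) * (rep p.v p.hv p.N n w : Mat p.N n)) := by
    rw [← Finset.sum_mul, ← Finset.sum_mul, ← Finset.mul_sum]
    have := sum_rep_tF (N := p.N) p.v p.hv i
    simp only [map_mul, Units.val_mul] at this
    rw [this]
    simp only [mul_smul_comm, smul_mul_assoc, mul_assoc]
  rw [h1, sigMat_mul_self p.v p.hv, mul_add, add_mul, mul_one, wtTrace_add, mul_smul_comm,
    smul_mul_assoc, wtTrace_smul, wtTrace_smul, Param.val]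
  field_simp

end Generic

/-! ### The Yokonuma–Hecke algebras as a tower -/

theorem framedToY_apply (d n : ℕ) (q : ℂ) (w : FramedBraidGroup d n) :
    framedToY d n q w = toY d n q (MonoidAlgebra.of ℂ _ w) := rfl

theorem span_range_of (d n : ℕ) :
    Submodule.span ℂ (Set.range (MonoidAlgebra.of ℂ (FramedBraidGroup d n))) = ⊤ := by
  refine eq_top_iff.2 fun a _ => ?_
  induction a using MonoidAlgebra.induction_on with
  | of w => exact Submodule.subset_span ⟨w, rfl⟩
  | add a b ha hb => exact add_mem (ha trivial) (hb trivial)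
  | smul c a ha => exact Submodule.smul_mem _ _ (ha trivial)

theorem toY_surjective (d n : ℕ) (q : ℂ) : Function.Surjective (toY d n q) :=
  RingQuot.mkAlgHom_surjective ℂ _

theorem span_range_framedToY (d n : ℕ) (q : ℂ) :
    Submodule.span ℂ (Set.range (framedToY d n q)) = ⊤ := by
  have h : Set.range (framedToY d n q) =
      (toY d n q).toLinearMap '' Set.range (MonoidAlgebra.of ℂ (FramedBraidGroup d n)) := by
    rw [← Set.range_comp]; rfl
  rw [h, ← Submodule.map_span, span_range_of, Submodule.map_top]
  exact LinearMap.range_eq_top.2 (toY_surjective d n q)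

theorem incl_toY (d n : ℕ) (q : ℂ) (a : MonoidAlgebra ℂ (FramedBraidGroup d n)) :
    incl d n q (toY d n q a) = toY d (n + 1) q (inclA d n a) :=
  RingQuot.liftAlgHom_mkAlgHom_apply ℂ _ _ _

theorem incl_framedToY (d n : ℕ) (q : ℂ) (w : FramedBraidGroup d n) :
    incl d n q (framedToY d n q w) = framedToY d (n + 1) q (inclF d n w) := by
  rw [framedToY_apply, incl_toY, inclA_of, framedToY_apply]

theorem framedToY_quad (d n : ℕ) (q : ℂ) (i : Fin (n - 1)) :
    framedToY d n q (σF d i) * framedToY d n q (σF d i) = 1 + (1 / (d : ℂ) * (q - q⁻¹)) •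
      ((∑ s ∈ Finset.Icc 1 d, framedToY d n q (tF d (lo i) ^ s * (tF d (hi i) ^ s)⁻¹)) *
        framedToY d n q (σF d i)) := by
  have := RingQuot.mkAlgHom_rel ℂ (QuadRel.quad (d := d) (n := n) (q := q) i)
  change toY d n q _ = toY d n q _ at this
  rw [map_pow, sq, map_add, map_one, map_smul, map_mul, eF, map_smul, map_sum] at this
  rw [framedToY_apply, this, smul_mul_assoc, smul_smul, mul_comm (q - q⁻¹)]
  rfl

/-- The Yokonuma–Hecke algebras as a tower. -/
def yTower (d : ℕ) (q : ℂ) : Tower ℂ d (1 / (d : ℂ) * (q - q⁻¹)) (fun n => Y d n q) where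
  ρ n := framedToY d n q
  ι n := incl d n q
  ι_ρ n := incl_framedToY d n q
  quad n := framedToY_quad d n q

theorem yTower_B (d : ℕ) (q : ℂ) (n : ℕ) : (yTower d q).B n = ⊤ := span_range_framedToY d n q

theorem mem_yTower_B {d : ℕ} {q : ℂ} {n : ℕ} (a : Y d n q) : a ∈ (yTower d q).B n := by
  rw [yTower_B]; exact trivial

/-- Induction on the elements of the Yokonuma–Hecke algebra. -/
theorem Y_induction {d n : ℕ} {q : ℂ} {P : Y d n q → Prop} (hw : ∀ w, P (framedToY d n q w))
    (hadd : ∀ a b, P a → P b → P (a + b)) (hsmul : ∀ (c : ℂ) a, P a → P (c • a)) (a : Y d n q) :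
    P a := by
  have ha : a ∈ Submodule.span ℂ (Set.range (framedToY d n q)) := by
    rw [span_range_framedToY]; exact trivial
  induction ha using Submodule.span_induction with
  | mem x hx => obtain ⟨w, rfl⟩ := hx; exact hw w
  | zero => simpa using hsmul 0 _ (hw 1)
  | add x y _ _ hx hy => exact hadd x y hx hy
  | smul c x _ hx => exact hsmul c x hx

/-! ### Existence of the Juyumaya trace -/

/-- A linear map that is compatible with the quadratic relations vanishes on the kernel of the
projection onto the Yokonuma–Hecke algebra. -/
theorem ker_toY_le {d n : ℕ} {q : ℂ} {R : Type*} [AddCommGroup R] [Module ℂ R]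
    (f : MonoidAlgebra ℂ (FramedBraidGroup d n) →ₗ[ℂ] R)
    (hf : ∀ a b u v, QuadRel d n q u v → f (a * u * b) = f (a * v * b)) :
    LinearMap.ker (toY d n q).toLinearMap ≤ LinearMap.ker f := by
  intro u hu
  have h0 : toY d n q u = toY d n q 0 := by rw [map_zero]; exact hu
  have h1 : Quot.mk (RingQuot.Rel (QuadRel d n q)) u = Quot.mk _ 0 := by
    simpa [toY, RingQuot.mkAlgHom_def, RingQuot.mkRingHom_def] using h0
  -- Elements with equal image are linked by a chain of `RingQuot.Rel` steps. Keeping `a` and `b`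
  -- arbitrary lets them absorb the factors from the multiplication clauses.
  have key : ∀ x y, Relation.EqvGen (RingQuot.Rel (QuadRel d n q)) x y →
      ∀ a b, f (a * x * b) = f (a * y * b) := by
    intro x y h
    induction h with
    | rel x y h =>
      induction h with
      | of h => exact fun a b => hf a b _ _ h
      | add_left _ ih =>
        intro a b
        simp only [mul_add, add_mul, map_add, ih]
      | mul_left _ ih =>
        intro a b
        simpa only [mul_assoc] using ih a (_ * b)
      | mul_right _ ih =>
        intro a b
        simpa only [mul_assoc] using ih (a * _) b
    | refl => exact fun _ _ => rfl
    | symm _ _ _ ih => exact fun a b => (ih a b).symm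
    | trans _ _ _ _ _ ih ih' => exact fun a b => (ih a b).trans (ih' a b)
  have := key u 0 (Quot.eqvGen_exact h1) 1 1
  simpa using this

section Existence

variable (d : ℕ) [NeZero d] (q : ℂ)

/-- The specialization of the generic parameters. -/
def specGen : GenRing d →ₐ[ℂ] TraceRing d := MvPolynomial.aeval fun o =>
  o.elim (MvPolynomial.C (q - q⁻¹)) fun o' => o'.elim (MvPolynomial.X none) fun k =>
    MvPolynomial.C (1 / (d : ℂ)) *
      ∑ s : ZMod d, xVar d s * MvPolynomial.C (ZMod.stdAddChar (-(s * k)))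

theorem specGen_coeff : specGen d q (MvPolynomial.C (1 / (d : ℂ)) * MvPolynomial.X none) =
    algebraMap ℂ (TraceRing d) (1 / (d : ℂ) * (q - q⁻¹)) := by
  rw [map_mul, map_mul, specGen, MvPolynomial.aeval_X, MvPolynomial.algHom_C]
  rfl

/-- Fourier inversion: `specGen` takes the colour weights to be the inverse transform of the `x_s`,
so the framing factor of `genTrace` becomes `x_s`. -/
theorem specGen_sum (s : ZMod d) :
    specGen d q (∑ k, MvPolynomial.X (some (some k)) *
      MvPolynomial.C (ZMod.stdAddChar (s * k))) = xVar d s := by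
  have hd : (d : ℂ) ≠ 0 := NeZero.ne _
  have h1 : ∀ k, specGen d q (MvPolynomial.X (some (some k)) *
      MvPolynomial.C (ZMod.stdAddChar (s * k))) = ∑ s' : ZMod d, MvPolynomial.C (1 / (d : ℂ)) *
        (xVar d s' * MvPolynomial.C (ZMod.stdAddChar (k * (s - s')))) := by
    intro k
    rw [map_mul, specGen, MvPolynomial.aeval_X, MvPolynomial.algHom_C]
    change MvPolynomial.C (1 / (d : ℂ)) * (∑ s' : ZMod d, _) * _ = _
    rw [Finset.mul_sum, Finset.sum_mul]
    refine Finset.sum_congr rfl fun s' _ => ?_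
    rw [MvPolynomial.algebraMap_eq, mul_assoc, mul_assoc, ← map_mul, ← AddChar.map_add_eq_mul]
    congr 4
    ring
  rw [map_sum, Finset.sum_congr rfl fun k _ => h1 k, Finset.sum_comm]
  simp only [← Finset.mul_sum, ← map_sum, sum_stdAddChar]
  rw [Finset.sum_eq_single s]
  · rw [sub_self, if_pos rfl, mul_left_comm, ← map_mul, one_div, inv_mul_cancel₀ hd, map_one,
      mul_one]
  · intro b _ hb
    rw [if_neg (sub_ne_zero.2 hb.symm), map_zero, mul_zero]
  · simp

/-- The trace on the group algebra of the framed braid group. -/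
def preTrace (n : ℕ) : MonoidAlgebra ℂ (FramedBraidGroup d n) →ₗ[ℂ] TraceRing d :=
  (Finsupp.linearCombination ℂ fun w => specGen d q (genTrace d w)) ∘ₗ
    (MonoidAlgebra.coeffLinearEquiv ℂ).toLinearMap

theorem preTrace_of {n : ℕ} (w : FramedBraidGroup d n) :
    preTrace d q n (MonoidAlgebra.of ℂ _ w) = specGen d q (genTrace d w) := by
  simp [preTrace]

theorem preTrace_quad {n : ℕ} (a b u v : MonoidAlgebra ℂ (FramedBraidGroup d n))
    (h : QuadRel d n q u v) : preTrace d q n (a * u * b) = preTrace d q n (a * v * b) := by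
  induction a using MonoidAlgebra.induction_on with
  | of w =>
    induction b using MonoidAlgebra.induction_on with
    | of w' =>
      obtain ⟨i⟩ := h
      rw [mul_add, mul_one, mul_smul_comm, add_mul, smul_mul_assoc, eF, smul_mul_assoc,
        mul_smul_comm, smul_mul_assoc, Finset.sum_mul, Finset.mul_sum, Finset.sum_mul, smul_smul,
        map_add, map_smul, map_sum]
      simp only [← map_mul, ← map_pow, preTrace_of]
      rw [genTrace_quad, map_add, map_mul, specGen_coeff, map_sum, mul_comm (q - q⁻¹),
        Algebra.smul_def]
      simp only [mul_assoc]
    | add x y hx hy => rw [mul_add, mul_add, map_add, map_add, hx, hy]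
    | smul c x hx => rw [mul_smul_comm, mul_smul_comm, map_smul, map_smul, hx]
  | add x y hx hy => simp only [add_mul, map_add, hx, hy]
  | smul c x hx => simp only [smul_mul_assoc, map_smul, hx]

/-- The trace on the Yokonuma–Hecke algebras. -/
def yTrace (n : ℕ) : Y d n q →ₗ[ℂ] TraceRing d :=
  (LinearMap.ker (toY d n q).toLinearMap).liftQ (preTrace d q n)
      (ker_toY_le _ (preTrace_quad d q)) ∘ₗ
    ((toY d n q).toLinearMap.quotKerEquivOfSurjective (toY_surjective d n q)).symm.toLinearMap

theorem yTrace_framedToY {n : ℕ} (w : FramedBraidGroup d n) :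
    yTrace d q n (framedToY d n q w) = specGen d q (genTrace d w) := by
  have h : ((toY d n q).toLinearMap.quotKerEquivOfSurjective (toY_surjective d n q)).symm
      (framedToY d n q w) = Submodule.Quotient.mk (MonoidAlgebra.of ℂ _ w) := by
    rw [LinearEquiv.symm_apply_eq]; rfl
  rw [yTrace, LinearMap.comp_apply, LinearEquiv.coe_coe, h, Submodule.liftQ_apply, preTrace_of]

theorem yTrace_isMarkovTrace :
    IsMarkovTrace d q (MvPolynomial.X none) (xVar d) (yTrace d q) := by
  have hfr : ∀ (n : ℕ) (a : Y d n q) (s : ℕ),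
      yTrace d q (n + 1) (incl d n q a * t d q (Fin.last n) ^ s) =
        xVar d (s : ZMod d) * yTrace d q n a := by
    intro n a s
    induction a using Y_induction with
    | hw w =>
      rw [incl_framedToY, t, ← map_pow, ← map_mul, yTrace_framedToY, yTrace_framedToY,
        genTrace_incl_t, map_mul, specGen_sum]
    | hadd a b ha hb => rw [map_add, add_mul, map_add, ha, hb, map_add, mul_add]
    | hsmul c a ha =>
      rw [map_smul, smul_mul_assoc, map_smul, ha, map_smul, mul_smul_comm]
  -- Compatibility with the inclusions is the framing rule at `s = 0`, as `xVar d 0 = 1`.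
  have hcompat : ∀ (n : ℕ) (a : Y d n q), yTrace d q (n + 1) (incl d n q a) = yTrace d q n a := by
    intro n a
    simpa [xVar] using hfr n a 0
  refine ⟨hcompat, fun n a b => ?_, fun n => ?_, fun n a => ?_, fun n a s _ _ => hfr n a s⟩
  · induction a using Y_induction with
    | hw w =>
      induction b using Y_induction with
      | hw w' =>
        rw [← map_mul, ← map_mul, yTrace_framedToY, yTrace_framedToY, genTrace_mul_comm]
      | hadd a b ha hb => rw [mul_add, add_mul, map_add, map_add, ha, hb]
      | hsmul c a ha => rw [mul_smul_comm, smul_mul_assoc, map_smul, map_smul, ha]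
    | hadd a b ha hb => rw [mul_add, add_mul, map_add, map_add, ha, hb]
    | hsmul c a ha => rw [mul_smul_comm, smul_mul_assoc, map_smul, map_smul, ha]
  · induction n with
    | zero =>
      rw [← map_one (framedToY d 0 q), yTrace_framedToY, genTrace_zero, map_one]
    | succ n ih => rw [← map_one (incl d n q), hcompat, ih]
  · induction a using Y_induction with
    | hw w =>
      rw [incl_framedToY, g, ← map_mul, yTrace_framedToY, yTrace_framedToY]
      rw [genTrace_incl_g, map_mul]
      simp [specGen]
    | hadd a b ha hb => rw [map_add, add_mul, map_add, ha, hb, map_add, mul_add]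
    | hsmul c a ha =>
      rw [map_smul, smul_mul_assoc, map_smul, ha, map_smul, mul_smul_comm]

/-- `juyumayaTrace` is zero by default if there is no Markov trace; `yTrace` excludes that branch.
-/
theorem juyumayaTrace_isMarkovTrace :
    IsMarkovTrace d q (MvPolynomial.X none) (xVar d) (juyumayaTrace d q) := by
  have h : ∃ tr : (n : ℕ) → Y d n q →ₗ[ℂ] TraceRing d,
      IsMarkovTrace d q (MvPolynomial.X none) (xVar d) tr := ⟨_, yTrace_isMarkovTrace d q⟩
  rw [juyumayaTrace, dif_pos h]
  exact h.choose_spec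

/-- The specialized trace obeys the rules of a Markov trace. -/
theorem specTrace_isMarkovTrace (x : ZMod d → ℂ) :
    IsMarkovTrace d q Polynomial.X (fun s => Polynomial.C (x s)) (specTrace d q x) := by
  have h := juyumayaTrace_isMarkovTrace d q
  refine ⟨fun n a => ?_, fun n a b => ?_, fun n => ?_, fun n a => ?_, fun n a s hs hs' => ?_⟩
  · simp only [specTrace, LinearMap.comp_apply, h.compat]
  · simp only [specTrace, LinearMap.comp_apply, h.comm n a b]
  · simp [specTrace, LinearMap.comp_apply, h.one]
  · simp [specTrace, LinearMap.comp_apply, h.markov]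
  · have hs0 : (s : ZMod d) ≠ 0 := by
      rw [Ne, ZMod.natCast_eq_zero_iff]
      exact Nat.not_dvd_of_pos_of_lt hs hs'
    simp [specTrace, LinearMap.comp_apply, h.framing n a s hs hs', xVar, hs0]

end Existence

/-! ### Colour projections -/

section Colour

variable {d n : ℕ} (q : ℂ)

theorem t_pow_d (j : Fin n) : t d q j ^ d = 1 := by
  rw [t, ← map_pow, tF_pow, map_one]

theorem t_commute (i j : Fin n) : Commute (t d q i) (t d q j) := by
  rw [Commute, SemiconjBy, t, t, ← map_mul, ← map_mul, tF_comm]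

theorem incl_t (j : Fin n) : incl d n q (t d q j) = t d q j.castSucc := by
  rw [t, incl_framedToY, inclF_tF]; rfl

theorem t_mul_g (i : Fin (n - 1)) (j : Fin n) :
    t d q j * g d q i = g d q i * t d q (sTr i j) := by
  rw [t, g, t, ← map_mul, ← map_mul, tF_σF]

theorem t_pow_natCast_val (j : Fin n) (s : ℕ) : t d q j ^ (s : ZMod d).val = t d q j ^ s := by
  rw [ZMod.val_natCast, ← pow_mod_orderOf, Nat.mod_mod_of_dvd _ (orderOf_dvd_of_pow_eq_one
    (t_pow_d q j)), pow_mod_orderOf]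

variable [NeZero d]

/-- The projection onto the colour `k` of the strand `j`. -/
def colour (k : ZMod d) (j : Fin n) : Y d n q :=
  (1 / (d : ℂ)) • ∑ s : ZMod d, (ZMod.stdAddChar (-(s * k)) : ℂ) • t d q j ^ s.val

/-- A shift of the summation index by one absorbs the extra `t_j`. -/
theorem t_mul_colour (k : ZMod d) (j : Fin n) :
    t d q j * colour q k j = (ZMod.stdAddChar k : ℂ) • colour q k j := by
  rw [colour, mul_smul_comm, smul_comm]
  congr 1
  rw [Finset.mul_sum, Finset.smul_sum,
    ← Equiv.sum_comp (Equiv.addRight (1 : ZMod d)) fun s : ZMod d =>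
      (ZMod.stdAddChar k : ℂ) • (ZMod.stdAddChar (-(s * k)) : ℂ) • t d q j ^ s.val]
  refine Finset.sum_congr rfl fun s _ => ?_
  rw [mul_smul_comm, ← pow_succ', smul_smul, ← AddChar.map_add_eq_mul, Equiv.coe_addRight]
  congr 1
  · congr 1; ring
  · rw [← t_pow_natCast_val q j (s.val + 1)]
    simp

theorem t_pow_mul_colour (k : ZMod d) (j : Fin n) (s : ℕ) :
    t d q j ^ s * colour q k j = (ZMod.stdAddChar k : ℂ) ^ s • colour q k j := by
  induction s with
  | zero => simp
  | succ s ih => rw [pow_succ, mul_assoc, t_mul_colour, mul_smul_comm, ih, smul_smul, pow_succ']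

theorem colour_mul_self (k : ZMod d) (j : Fin n) :
    colour q k j * colour q k j = colour q k j := by
  have hd : (d : ℂ) ≠ 0 := NeZero.ne _
  have h : ∀ s : ZMod d, (ZMod.stdAddChar (-(s * k)) : ℂ) • t d q j ^ s.val * colour q k j =
      colour q k j := by
    intro s
    rw [smul_mul_assoc, t_pow_mul_colour, smul_smul, ← AddChar.map_nsmul_eq_pow,
      ← AddChar.map_add_eq_mul]
    simp
  nth_rw 1 [colour]
  rw [smul_mul_assoc, Finset.sum_mul, Finset.sum_congr rfl fun s _ => h s, Finset.sum_const,
    Finset.card_univ, ZMod.card, ← Nat.cast_smul_eq_nsmul ℂ, smul_smul, one_div,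
    inv_mul_cancel₀ hd, one_smul]

theorem sum_colour (j : Fin n) : ∑ k : ZMod d, colour q k j = 1 := by
  have hd : (d : ℂ) ≠ 0 := NeZero.ne _
  simp only [colour]
  rw [← Finset.smul_sum, Finset.sum_comm]
  simp only [← Finset.sum_smul]
  simp only [sum_stdAddChar_neg, ite_smul, zero_smul, Finset.sum_ite_eq', Finset.mem_univ, if_true]
  rw [smul_smul, one_div, inv_mul_cancel₀ hd, one_smul, ZMod.val_zero, pow_zero]

theorem commute_colour {b : Y d n q} {j : Fin n} (h : Commute b (t d q j)) (k : ZMod d) :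
    Commute b (colour q k j) :=
  (Commute.sum_right _ _ _ fun s _ => (h.pow_right s.val).smul_right _).smul_right _

theorem semiconj_colour {b : Y d n q} {i j : Fin n} (h : SemiconjBy b (t d q j) (t d q i))
    (k : ZMod d) : SemiconjBy b (colour q k j) (colour q k i) := by
  rw [SemiconjBy, colour, colour, mul_smul_comm, smul_mul_assoc, Finset.mul_sum, Finset.sum_mul]
  congr 1
  refine Finset.sum_congr rfl fun s _ => ?_
  rw [mul_smul_comm, smul_mul_assoc, (h.pow_right s.val).eq]

theorem colour_commute (k : ZMod d) (i j : Fin n) : Commute (colour q k i) (colour q k j) :=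
  commute_colour q (commute_colour q (t_commute q j i) k).symm k

theorem incl_colour (k : ZMod d) (j : Fin n) :
    incl d n q (colour q k j) = colour q k j.castSucc := by
  simp only [colour, map_smul, map_sum, map_pow, incl_t]

/-- The projection onto the colour `k` of all strands. -/
def allColour (n : ℕ) (k : ZMod d) : Y d n q := (List.ofFn (colour q k)).prod

theorem allColour_succ (k : ZMod d) :
    allColour q (n + 1) k = incl d n q (allColour q n k) * colour q k (Fin.last n) := by
  rw [allColour, List.ofFn_succ', List.concat_eq_append, List.prod_append, List.prod_singleton,
    allColour, map_list_prod, List.map_ofFn]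
  congr 3
  funext j
  exact (incl_colour q k j).symm

theorem allColour_mul_colour_last (k : ZMod d) :
    allColour q (n + 1) k * colour q k (Fin.last n) = allColour q (n + 1) k := by
  rw [allColour_succ, mul_assoc, colour_mul_self]

theorem allColour_commute_t (k : ZMod d) (j : Fin n) :
    Commute (allColour q n k) (t d q j) := by
  refine Commute.list_prod_left _ _ fun x hx => ?_
  obtain ⟨i, rfl⟩ := (List.mem_ofFn' _ _).1 hx
  exact (commute_colour q (t_commute q j i) k).symm

/-- Crossing `g_i` permutes the strands of the projections. All strands carry the same colour, so
the product is merely reordered, and its factors commute pairwise. -/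
theorem allColour_commute_g (k : ZMod d) (i : Fin (n - 1)) :
    Commute (allColour q n k) (g d q i) := by
  have h : ∀ l : List (Fin n), (l.map (colour q k)).prod * g d q i =
      g d q i * (l.map fun j => colour q k (sTr i j)).prod := by
    intro l
    induction l with
    | nil => simp
    | cons j l ih =>
      have hj : SemiconjBy (g d q i) (colour q k (sTr i j)) (colour q k j) :=
        semiconj_colour q (t_mul_g q i j).symm k
      rw [List.map_cons, List.prod_cons, mul_assoc, ih, ← mul_assoc, ← hj.eq, mul_assoc,
        List.map_cons, List.prod_cons]
  have hp : (List.ofFn (colour q k ∘ sTr i)).prod = (List.ofFn (colour q k)).prod := by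
    refine List.Perm.prod_eq' (Equiv.Perm.ofFn_comp_perm (sTr i) (colour q k)) ?_
    refine List.pairwise_of_forall_mem_list fun a ha b hb => ?_
    obtain ⟨_, rfl⟩ := (List.mem_ofFn' _ _).1 ha
    obtain ⟨_, rfl⟩ := (List.mem_ofFn' _ _).1 hb
    exact colour_commute q k _ _
  have := h (List.finRange n)
  rw [← List.ofFn_eq_map, ← List.ofFn_eq_map] at this
  rw [Commute, SemiconjBy, allColour, this]
  exact congrArg _ hp

/-- Centrality lets the projection pass through the product `b a` produced by the cyclic Markov rule
in `fieldTrace_allColour`. -/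
theorem allColour_commute (k : ZMod d) (a : Y d n q) : Commute (allColour q n k) a := by
  induction a using Y_induction with
  | hw w =>
    let H : Subgroup (FramedBraidGroup d n) :=
      { carrier := {w | Commute (allColour q n k) (framedToY d n q w)}
        mul_mem' := fun {a b} ha hb => by
          have : Commute _ _ := ha.mul_right hb
          rwa [← map_mul] at this
        one_mem' := by simp
        inv_mem' := fun {a} ha => by
          have h : Commute (allColour q n k) (((framedToY d n q).toHomUnits a : (Y d n q)ˣ) :
            Y d n q) := ha
          have := h.units_inv_right
          rwa [← map_inv] at this }
    exact framed_generated d n H (allColour_commute_g q k) (allColour_commute_t q k) w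
  | hadd a b ha hb => exact ha.add_right hb
  | hsmul c a ha => exact ha.smul_right c

end Colour

/-! ### The homomorphisms onto the Hecke algebras -/

section Hecke

variable {d : ℕ} (n : ℕ)

/-- The map `F_{d,n} → F_{1,n}` that forgets the framings. -/
def forget (d n : ℕ) : FramedBraidGroup d n →* FramedBraidGroup 1 n :=
  PresentedGroup.toGroup (f := Sum.elim (fun i => σF 1 i) (fun _ => 1)) (by
    rintro w (⟨i, j, h⟩ | ⟨i, j, h⟩ | ⟨i, j⟩ | ⟨i, j⟩ | ⟨j⟩) <;>
      simp only [fσ, ft, map_mul, map_inv, map_pow, FreeGroup.lift_apply_of, Sum.elim_inl,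
        Sum.elim_inr, mul_inv_eq_one]
    · exact σF_braid 1 _ _ h
    · exact σF_comm 1 _ _ h
    · rw [one_mul, mul_one]
    · rw [one_pow])

theorem forget_σF {n : ℕ} (i : Fin (n - 1)) : forget d n (σF d i) = σF 1 i :=
  PresentedGroup.toGroup.of _

theorem forget_tF {n : ℕ} (j : Fin n) : forget d n (tF d j) = 1 :=
  PresentedGroup.toGroup.of _

theorem forget_inclF (w : FramedBraidGroup d n) :
    forget d (n + 1) (inclF d n w) = inclF 1 n (forget d n w) := by
  have : (forget d (n + 1)).comp (inclF d n) = (inclF 1 n).comp (forget d n) := by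
    refine PresentedGroup.ext ?_
    rintro (i | j)
    · change forget d (n + 1) (inclF d n (σF d i)) = inclF 1 n (forget d n (σF d i))
      rw [inclF_σF, forget_σF, forget_σF, inclF_σF]
    · change forget d (n + 1) (inclF d n (tF d j)) = inclF 1 n (forget d n (tF d j))
      rw [inclF_tF, forget_tF, forget_tF, map_one]
  exact DFunLike.congr_fun this w

theorem forget_braidToFramed (α : BraidGroup n) :
    forget d n (braidToFramed d n α) = braidToFramed 1 n α := by
  have : (forget d n).comp (braidToFramed d n) = braidToFramed 1 n := by
    refine PresentedGroup.ext fun i => ?_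
    change forget d n (braidToFramed d n (PresentedGroup.of i)) =
      braidToFramed 1 n (PresentedGroup.of i)
    rw [braidToFramed, braidToFramed, PresentedGroup.toGroup.of, PresentedGroup.toGroup.of,
      forget_σF]
  exact DFunLike.congr_fun this α

variable [NeZero d]

/-- The value of an additive character, as a unit. -/
def charUnit (k : ZMod d) : ℂˣ where
  val := ZMod.stdAddChar k
  inv := ZMod.stdAddChar (-k)
  val_inv := by rw [← AddChar.map_add_eq_mul, add_neg_cancel, AddChar.map_zero_eq_one]
  inv_val := by rw [← AddChar.map_add_eq_mul, neg_add_cancel, AddChar.map_zero_eq_one]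

/-- The character `σ_i ↦ 1`, `t_j ↦ χ(k)` of the framed braid group. -/
def colourChar (k : ZMod d) : FramedBraidGroup d n →* ℂˣ :=
  PresentedGroup.toGroup (f := Sum.elim (fun _ => 1) (fun _ => charUnit k)) (by
    rintro w (⟨i, j, h⟩ | ⟨i, j, h⟩ | ⟨i, j⟩ | ⟨i, j⟩ | ⟨j⟩) <;>
      simp only [fσ, ft, map_mul, map_inv, map_pow, FreeGroup.lift_apply_of, Sum.elim_inl,
        Sum.elim_inr, mul_inv_eq_one]
    · rw [one_mul, mul_one]
    · refine Units.ext ?_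
      rw [Units.val_pow_eq_pow_val]
      change (ZMod.stdAddChar k : ℂ) ^ d = 1
      rw [← AddChar.map_nsmul_eq_pow]
      simp)

theorem colourChar_σF {n : ℕ} (k : ZMod d) (i : Fin (n - 1)) : colourChar n k (σF d i) = 1 :=
  PresentedGroup.toGroup.of _

theorem colourChar_tF {n : ℕ} (k : ZMod d) (j : Fin n) :
    colourChar n k (tF d j) = charUnit k :=
  PresentedGroup.toGroup.of _

theorem colourChar_inclF (k : ZMod d) (w : FramedBraidGroup d n) :
    colourChar (n + 1) k (inclF d n w) = colourChar n k w := by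
  have : (colourChar (n + 1) k).comp (inclF d n) = colourChar n k := by
    refine PresentedGroup.ext ?_
    rintro (i | j)
    · change colourChar (n + 1) k (inclF d n (σF d i)) = colourChar n k (σF d i)
      rw [inclF_σF, colourChar_σF, colourChar_σF]
    · change colourChar (n + 1) k (inclF d n (tF d j)) = colourChar n k (tF d j)
      rw [inclF_tF, colourChar_tF, colourChar_tF]
  exact DFunLike.congr_fun this w

theorem colourChar_braidToFramed (k : ZMod d) (α : BraidGroup n) :
    colourChar n k (braidToFramed d n α) = 1 := by
  have : (colourChar n k).comp (braidToFramed d n) = 1 := by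
    refine PresentedGroup.ext fun i => ?_
    change colourChar n k (braidToFramed d n (PresentedGroup.of i)) = 1
    rw [braidToFramed, PresentedGroup.toGroup.of, colourChar_σF]
  exact DFunLike.congr_fun this α

variable (q : ℂ)

/-- The map from the framed braid group to the Hecke algebra that sends all framing generators to
`χ(k)`. -/
def toHeckeGroup (k : ZMod d) : FramedBraidGroup d n →* Y 1 n q where
  toFun w := (colourChar n k w : ℂ) • framedToY 1 n q (forget d n w)
  map_one' := by simp
  map_mul' a b := by
    rw [map_mul, map_mul, map_mul, smul_mul_smul_comm, Units.val_mul]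

theorem toHeckeGroup_apply (k : ZMod d) (w : FramedBraidGroup d n) : toHeckeGroup n q k w =
    (colourChar n k w : ℂ) • framedToY 1 n q (forget d n w) := rfl

theorem hecke_quad (i : Fin (n - 1)) : framedToY 1 n q (σF 1 i) * framedToY 1 n q (σF 1 i) =
    1 + (q - q⁻¹) • framedToY 1 n q (σF 1 i) := by
  have ht : ∀ j : Fin n, tF 1 j = 1 := fun j => by simpa using tF_pow 1 j
  rw [framedToY_quad]
  simp [ht]

/-- The homomorphism `Y_{d,n}(q) → Y_{1,n}(q)`, `g_i ↦ g_i`, `t_j ↦ χ(k)`. -/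
def toHecke (k : ZMod d) : Y d n q →ₐ[ℂ] Y 1 n q :=
  RingQuot.liftAlgHom ℂ ⟨MonoidAlgebra.lift ℂ (Y 1 n q) (FramedBraidGroup d n)
    (toHeckeGroup n q k), by
    rintro _ _ ⟨i⟩
    have hd : (d : ℂ) ≠ 0 := NeZero.ne _
    have hσ : toHeckeGroup n q k (σF d i) = framedToY 1 n q (σF 1 i) := by
      rw [toHeckeGroup_apply, colourChar_σF, forget_σF, Units.val_one, one_smul]
    -- All framings go to the same scalar, so each term of `e_i` goes to 1 and the quadratic
    -- relation becomes that of the Hecke algebra.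
    have ht : ∀ s : ℕ, toHeckeGroup n q k (tF d (lo i) ^ s * (tF d (hi i) ^ s)⁻¹) = 1 := by
      intro s
      rw [toHeckeGroup_apply]
      simp only [map_mul, map_pow, map_inv, colourChar_tF, forget_tF]
      simp
    simp only [map_mul, map_pow] at ht
    simp only [map_pow, map_add, map_one, map_smul, map_mul, eF, map_sum, MonoidAlgebra.lift_of,
      hσ, ht]
    rw [sq, hecke_quad, Finset.sum_const, Nat.card_Icc, Nat.add_sub_cancel,
      ← Nat.cast_smul_eq_nsmul ℂ, smul_smul, one_div, inv_mul_cancel₀ hd, one_smul, one_mul]⟩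

theorem toHecke_framedToY (k : ZMod d) (w : FramedBraidGroup d n) :
    toHecke n q k (framedToY d n q w) =
      (colourChar n k w : ℂ) • framedToY 1 n q (forget d n w) := by
  rw [framedToY_apply, toHecke, toY, RingQuot.liftAlgHom_mkAlgHom_apply, MonoidAlgebra.lift_of]
  rfl

theorem toHecke_g {n : ℕ} (k : ZMod d) (i : Fin (n - 1)) :
    toHecke n q k (g d q i) = g 1 q i := by
  rw [g, toHecke_framedToY, colourChar_σF, forget_σF, Units.val_one, one_smul, g]

theorem toHecke_t {n : ℕ} (k : ZMod d) (j : Fin n) :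
    toHecke n q k (t d q j) = (ZMod.stdAddChar k : ℂ) • 1 := by
  rw [t, toHecke_framedToY, colourChar_tF, forget_tF, map_one]
  rfl

theorem toHecke_δ (k : ZMod d) (α : BraidGroup n) : toHecke n q k (δ d n q α) = δ 1 n q α := by
  change toHecke n q k (framedToY d n q (braidToFramed d n α)) =
    framedToY 1 n q (braidToFramed 1 n α)
  rw [toHecke_framedToY, colourChar_braidToFramed, forget_braidToFramed, Units.val_one, one_smul]

theorem toHecke_incl {n : ℕ} (k : ZMod d) (a : Y d n q) :
    toHecke (n + 1) q k (incl d n q a) = incl 1 n q (toHecke n q k a) := by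
  induction a using Y_induction with
  | hw w =>
    rw [incl_framedToY, toHecke_framedToY, toHecke_framedToY, map_smul, incl_framedToY,
      colourChar_inclF, forget_inclF]
  | hadd a b ha hb => simp only [map_add, ha, hb]
  | hsmul c a ha => simp only [map_smul, ha]

end Hecke

/-! ### Solutions of the E-system -/

section ESystem

variable {d : ℕ} [NeZero d]

/-- The Fourier coefficients of `x`. -/
def fourier (x : ZMod d → ℂ) (k : ZMod d) : ℂ :=
  1 / (d : ℂ) * ∑ s : ZMod d, x s * ZMod.stdAddChar (-(s * k))

theorem sum_fourier (x : ZMod d → ℂ) : ∑ k, fourier x k = x 0 := by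
  have hd : (d : ℂ) ≠ 0 := NeZero.ne _
  simp only [fourier]
  rw [← Finset.mul_sum, Finset.sum_comm]
  simp only [← Finset.mul_sum, sum_stdAddChar_neg, mul_ite, mul_zero, Finset.sum_ite_eq',
    Finset.mem_univ, if_true]
  field_simp

theorem sum_range_natCast {M : Type*} [AddCommMonoid M] (φ : ZMod d → M) :
    ∑ s ∈ Finset.range d, φ (s : ZMod d) = ∑ s : ZMod d, φ s := by
  refine Finset.sum_bij (fun s _ => (s : ZMod d)) (fun _ _ => Finset.mem_univ _) ?_ ?_
    (fun _ _ => rfl)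
  · intro a ha b hb hab
    rw [Finset.mem_range] at ha hb
    have := (ZMod.natCast_eq_natCast_iff' a b d).1 hab
    rwa [Nat.mod_eq_of_lt ha, Nat.mod_eq_of_lt hb] at this
  · intro k _
    exact ⟨k.val, Finset.mem_range.2 (ZMod.val_lt k), by simp⟩

/-- The E-system, completed by the trivial equation at `m = 0`, says that the convolution of `x`
with itself is `d E x`. The Fourier transform turns this into an equation for squares: every
coefficient is 0 or `E`. -/
theorem fourier_sq {x : ZMod d → ℂ} (hx : IsESolution d x) (k : ZMod d) :
    fourier x k * fourier x k = E d x * fourier x k := by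
  have hd : (d : ℂ) ≠ 0 := NeZero.ne _
  have hE : ∀ m, 1 / (d : ℂ) * ∑ s : ZMod d, x (m + s) * x (-s) = x m * E d x := by
    intro m
    have h1 : Esum d x m = 1 / (d : ℂ) * ∑ s : ZMod d, x (m + s) * x (-s) := by
      rw [Esum, ← sum_range_natCast (fun s : ZMod d => x (m + s) * x (-s))]
      simp
    rw [← h1]
    rcases eq_or_ne m 0 with rfl | hm
    · rw [hx.zero, one_mul, E]
    · exact hx.eqn m hm
  have h2 : (∑ s : ZMod d, x s * (ZMod.stdAddChar (-(s * k)) : ℂ)) *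
      (∑ s : ZMod d, x s * (ZMod.stdAddChar (-(s * k)) : ℂ)) =
      ∑ m : ZMod d, (∑ s : ZMod d, x (m + s) * x (-s)) * (ZMod.stdAddChar (-(m * k)) : ℂ) := by
    rw [Finset.sum_mul_sum, Finset.sum_comm, ← Equiv.sum_comp (Equiv.neg (ZMod d))]
    have h3 : ∀ s : ZMod d, ∑ i : ZMod d, x i * (ZMod.stdAddChar (-(i * k)) : ℂ) *
        (x (Equiv.neg (ZMod d) s) * (ZMod.stdAddChar (-(Equiv.neg (ZMod d) s * k)) : ℂ)) =
        ∑ m : ZMod d, x (m + s) * x (-s) * (ZMod.stdAddChar (-(m * k)) : ℂ) := by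
      intro s
      rw [← Equiv.sum_comp (Equiv.addRight s)]
      refine Finset.sum_congr rfl fun m _ => ?_
      have : (ZMod.stdAddChar (-(m * k)) : ℂ) = ZMod.stdAddChar (-((m + s) * k)) *
          ZMod.stdAddChar (-(-s * k)) := by
        rw [← AddChar.map_add_eq_mul]
        congr 1; ring
      rw [this, Equiv.coe_addRight, Equiv.neg_apply]
      ring
    rw [Finset.sum_congr rfl fun s _ => h3 s, Finset.sum_comm]
    simp only [Finset.sum_mul]
  have h4 : ∀ m, ∑ s : ZMod d, x (m + s) * x (-s) = d * (x m * E d x) := by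
    intro m
    rw [← hE m]
    field_simp
  rw [fourier, mul_mul_mul_comm, h2]
  simp only [h4]
  rw [Finset.mul_sum, Finset.mul_sum, Finset.mul_sum]
  refine Finset.sum_congr rfl fun m _ => ?_
  field_simp

/-- With `E = 0` every Fourier coefficient would square to 0, while their sum is `x 0 = 1`. -/
theorem E_ne_zero {x : ZMod d → ℂ} (hx : IsESolution d x) : E d x ≠ 0 := by
  intro h
  have h1 : ∀ k, fourier x k = 0 := fun k => by
    have := fourier_sq hx k
    rw [h, zero_mul] at this
    exact mul_self_eq_zero.1 this
  have := sum_fourier x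
  rw [hx.zero] at this
  simp [h1] at this

theorem sum_fourier_pow {x : ZMod d → ℂ} (hx : IsESolution d x) (m : ℕ) :
    ∑ k, fourier x k ^ (m + 1) = E d x ^ m := by
  have h : ∀ k, fourier x k ^ (m + 1) = E d x ^ m * fourier x k := by
    intro k
    induction m with
    | zero => simp
    | succ m ih => rw [pow_succ, ih, mul_assoc, fourier_sq hx, ← mul_assoc, ← pow_succ]
  rw [Finset.sum_congr rfl fun k _ => h k, ← Finset.mul_sum, sum_fourier, hx.zero, mul_one]

end ESystem

/-! ### Traces with values in a field -/

theorem incl_commute_t_last {d : ℕ} {q : ℂ} (n : ℕ) (a : Y d n q) :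
    Commute (incl d n q a) (t d q (Fin.last n)) :=
  (yTower d q).commute_t (mem_yTower_B a)

section FieldTrace

variable {K : Type*} [Field K] [Algebra ℂ K]

/-- The trace with all parameters specialized. -/
def fieldTrace (d : ℕ) (q : ℂ) (x : ZMod d → ℂ) (z : K) (n : ℕ) : Y d n q →ₗ[ℂ] K :=
  (Polynomial.aeval z).toLinearMap ∘ₗ specTrace d q x n

variable {d : ℕ} [NeZero d] {q : ℂ} {x : ZMod d → ℂ} {z : K}

theorem fieldTrace_incl (n : ℕ) (a : Y d n q) :
    fieldTrace d q x z (n + 1) (incl d n q a) = fieldTrace d q x z n a :=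
  congrArg (Polynomial.aeval z) ((specTrace_isMarkovTrace d q x).compat n a)

theorem fieldTrace_comm (n : ℕ) (a b : Y d n q) :
    fieldTrace d q x z n (a * b) = fieldTrace d q x z n (b * a) :=
  congrArg (Polynomial.aeval z) ((specTrace_isMarkovTrace d q x).comm n a b)

theorem fieldTrace_one (n : ℕ) : fieldTrace d q x z n 1 = 1 := by
  have := congrArg (Polynomial.aeval z) ((specTrace_isMarkovTrace d q x).one n)
  rw [map_one (Polynomial.aeval z)] at this
  exact this

theorem fieldTrace_g (n : ℕ) (a : Y d (n + 1) q) :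
    fieldTrace d q x z (n + 2) (incl d (n + 1) q a * g d q (n := n + 2) (top n)) =
      z * fieldTrace d q x z (n + 1) a := by
  have := congrArg (Polynomial.aeval z) ((specTrace_isMarkovTrace d q x).markov n a)
  rw [map_mul (Polynomial.aeval z), Polynomial.aeval_X] at this
  exact this

/-- The framing rule omits `s = 0`; that case comes from compatibility and `x 0 = 1`. -/
theorem fieldTrace_t (hx : x 0 = 1) (n : ℕ) (a : Y d n q) (s : ZMod d) :
    fieldTrace d q x z (n + 1) (incl d n q a * t d q (Fin.last n) ^ s.val) =
      algebraMap ℂ K (x s) * fieldTrace d q x z n a := by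
  rcases eq_or_ne s 0 with rfl | hs
  · rw [ZMod.val_zero, pow_zero, mul_one, hx, map_one, one_mul, fieldTrace_incl]
  · have hs' : s.val ≠ 0 := by rwa [Ne, ZMod.val_eq_zero]
    have := congrArg (Polynomial.aeval z) ((specTrace_isMarkovTrace d q x).framing n a s.val
      (Nat.one_le_iff_ne_zero.2 hs') (ZMod.val_lt s))
    rw [map_mul (Polynomial.aeval z), Polynomial.aeval_C, ZMod.natCast_zmod_val] at this
    exact this

theorem fieldTrace_colour (hx : x 0 = 1) (n : ℕ) (a : Y d n q) (k : ZMod d) :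
    fieldTrace d q x z (n + 1) (incl d n q a * colour q k (Fin.last n)) =
      algebraMap ℂ K (fourier x k) * fieldTrace d q x z n a := by
  rw [colour, mul_smul_comm, map_smul, Finset.mul_sum, map_sum, fourier, map_mul, map_sum,
    Algebra.smul_def, mul_assoc, Finset.sum_mul]
  congr 1
  refine Finset.sum_congr rfl fun s _ => ?_
  rw [mul_smul_comm, map_smul, fieldTrace_t hx, Algebra.smul_def, map_mul]
  ring

/-- A family of linear maps on the Yokonuma–Hecke algebras is determined by its behaviour on the
standard elements. -/
theorem traces_unique (A : ℕ → K) (f f' : (n : ℕ) → Y d n q →ₗ[ℂ] K) (h0 : f 0 1 = f' 0 1)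
    (ht : ∀ n a s, f (n + 1) (incl d n q a * t d q (Fin.last n) ^ s) = A s * f n a)
    (ht' : ∀ n a s, f' (n + 1) (incl d n q a * t d q (Fin.last n) ^ s) = A s * f' n a)
    (hg : ∀ n a b, f (n + 2) (incl d (n + 1) q a * g d q (n := n + 2) (top n) *
      incl d (n + 1) q b) = z * f (n + 1) (b * a))
    (hg' : ∀ n a b, f' (n + 2) (incl d (n + 1) q a * g d q (n := n + 2) (top n) *
      incl d (n + 1) q b) = z * f' (n + 1) (b * a)) (n : ℕ) : f n = f' n := by
  induction n with
  | zero =>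
    refine LinearMap.ext fun a => ?_
    induction a using Y_induction with
    | hw w => rw [framed_zero_eq_one d w, map_one, h0]
    | hadd a b ha hb => rw [map_add, map_add, ha, hb]
    | hsmul c a ha => rw [map_smul, map_smul, ha]
  | succ n ih =>
    refine LinearMap.ext fun a => ?_
    have ha : a ∈ LinearMap.eqLocus (f (n + 1)) (f' (n + 1)) := by
      refine Submodule.span_le.2 ?_ ((yTower d q).B_le_span_std n (mem_yTower_B a))
      cases n with
      | zero =>
        rintro _ ⟨a, _, s, rfl⟩
        exact (ht 0 a s).trans ((congrArg _ (by rw [ih])).trans (ht' 0 a s).symm)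
      | succ n =>
        rintro _ (⟨a, _, s, rfl⟩ | ⟨a, _, b, _, rfl⟩)
        · exact (ht (n + 1) a s).trans ((congrArg _ (by rw [ih])).trans (ht' (n + 1) a s).symm)
        · exact (hg n a b).trans ((congrArg _ (by rw [ih])).trans (hg' n a b).symm)
    exact ha

/-- The part of the trace of a fixed colour is a multiple of the Ocneanu trace. -/
theorem fieldTrace_allColour (hx : IsESolution d x) (k : ZMod d) (n : ℕ) (a : Y d n q) :
    fieldTrace d q x z n (allColour q n k * a) = algebraMap ℂ K (fourier x k) ^ n *
      fieldTrace 1 q (fun _ => 1) (z / algebraMap ℂ K (E d x)) n (toHecke n q k a) := by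
  have hE : algebraMap ℂ K (E d x) ≠ 0 := by
    rw [Ne, FaithfulSMul.algebraMap_eq_zero_iff]; exact E_ne_zero hx
  have hc : algebraMap ℂ K (fourier x k) * algebraMap ℂ K (fourier x k) =
      algebraMap ℂ K (E d x) * algebraMap ℂ K (fourier x k) := by
    rw [← map_mul, ← map_mul, fourier_sq hx]
  let f : (n : ℕ) → Y d n q →ₗ[ℂ] K := fun n =>
    fieldTrace d q x z n ∘ₗ LinearMap.mulLeft ℂ (allColour q n k)
  let f' : (n : ℕ) → Y d n q →ₗ[ℂ] K := fun n =>
    LinearMap.mulLeft ℂ (algebraMap ℂ K (fourier x k) ^ n) ∘ₗ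
      fieldTrace 1 q (fun _ => 1) (z / algebraMap ℂ K (E d x)) n ∘ₗ (toHecke n q k).toLinearMap
  have hf : ∀ n a, f n a = fieldTrace d q x z n (allColour q n k * a) := fun _ _ => rfl
  have hf' : ∀ n a, f' n a = algebraMap ℂ K (fourier x k) ^ n *
    fieldTrace 1 q (fun _ => 1) (z / algebraMap ℂ K (E d x)) n (toHecke n q k a) := fun _ _ => rfl
  suffices h : f n = f' n by exact DFunLike.congr_fun h a
  -- Both families obey the same rules: a new framing `t^s` gives the factor `χ(k)^s c_k`, and a new
  -- braiding generator gives `z`.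
  refine traces_unique (z := z) (fun s => algebraMap ℂ K (ZMod.stdAddChar k) ^ s *
    algebraMap ℂ K (fourier x k)) f f' ?_ ?_ ?_ ?_ ?_ n
  · rw [hf, hf', map_one, fieldTrace_one, mul_one, pow_zero, mul_one]
    simp [allColour, fieldTrace_one]
  · intro n a s
    have h1 : Commute (incl d n q a) (colour q k (Fin.last n)) :=
      commute_colour q (incl_commute_t_last n a) k
    have h2 : Commute (colour q k (Fin.last n)) (t d q (Fin.last n) ^ s) :=
      (commute_colour q (Commute.refl _) k).symm.pow_right s
    rw [hf, hf, allColour_succ, mul_assoc, ← mul_assoc (colour q k _), ← h1.eq,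
      mul_assoc (incl d n q a), h2.eq, t_pow_mul_colour, mul_smul_comm, mul_smul_comm,
      ← mul_assoc, ← map_mul, map_smul, fieldTrace_colour hx.zero, Algebra.smul_def, map_pow,
      mul_assoc]
  · intro n a s
    rw [hf', hf', map_mul, map_pow, toHecke_t, toHecke_incl, smul_pow, one_pow, mul_smul_comm,
      mul_one, map_smul, fieldTrace_incl, Algebra.smul_def, map_pow]
    ring
  · intro n a b
    have h1 : Commute (incl d (n + 1) q a) (colour q k (Fin.last (n + 1))) :=
      commute_colour q (incl_commute_t_last (n + 1) a) k
    have h2 : SemiconjBy (g d q (n := n + 2) (top n)) (colour q k (Fin.last n).castSucc)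
        (colour q k (Fin.last (n + 1))) := by
      refine semiconj_colour q ?_ k
      rw [SemiconjBy, t_mul_g, ← hi_top, sTr_hi, lo_top]
    -- The projection on the new strand is pulled through `g` and becomes one on the previous
    -- strand.
    have h3 : allColour q (n + 2) k * (incl d (n + 1) q a * g d q (n := n + 2) (top n) *
        incl d (n + 1) q b) = incl d (n + 1) q (allColour q (n + 1) k * a) *
        g d q (n := n + 2) (top n) * incl d (n + 1) q (colour q k (Fin.last n) * b) := by
      rw [allColour_succ, map_mul, map_mul, incl_colour]
      calc _ = incl d (n + 1) q (allColour q (n + 1) k) *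
            (colour q k (Fin.last (n + 1)) * incl d (n + 1) q a) *
            g d q (n := n + 2) (top n) * incl d (n + 1) q b := by simp only [mul_assoc]
        _ = incl d (n + 1) q (allColour q (n + 1) k) * incl d (n + 1) q a *
            (colour q k (Fin.last (n + 1)) * g d q (n := n + 2) (top n)) *
            incl d (n + 1) q b := by rw [← h1.eq]; simp only [mul_assoc]
        _ = _ := by rw [← h2.eq]; simp only [mul_assoc]
    rw [hf, hf, h3, fieldTrace_comm, ← mul_assoc, ← map_mul, fieldTrace_g]
    congr 2
    -- The leftover projection is already contained in the central one and is absorbed by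
    -- idempotence.
    rw [mul_assoc, ← mul_assoc b, ← (allColour_commute q k b).eq, ← mul_assoc, ← mul_assoc,
      ← (allColour_commute q k (colour q k (Fin.last n))).eq, allColour_mul_colour_last, mul_assoc]
  · intro n a b
    rw [hf', hf', map_mul (toHecke (n + 2) q k), map_mul (toHecke (n + 2) q k), toHecke_incl,
      toHecke_incl, toHecke_g, fieldTrace_comm,
      ← mul_assoc, ← map_mul, fieldTrace_g, map_mul (toHecke (n + 1) q k),
      pow_succ, pow_succ]
    generalize fieldTrace 1 q (fun _ => 1) (z / algebraMap ℂ K (E d x)) (n + 1) _ = V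
    -- One of the two surplus factors `c_k` is traded for `E`, which cancels the denominator of `z /
    -- E`. This forces the rescaled Ocneanu parameter.
    rw [mul_assoc (_ ^ n), hc]
    field_simp

end FieldTrace

/-! ### Braids whose closure is a knot -/

section Knot

variable {n : ℕ}

theorem braid_generated (H : Subgroup (BraidGroup n)) (h : ∀ i, PresentedGroup.of i ∈ H)
    (α : BraidGroup n) : α ∈ H := PresentedGroup.generated_by _ H h α

theorem exists_zpow_of_knot {α : BraidGroup n} (hα : ClosureIsKnot α) (i j : Fin n) :
    ∃ m : ℤ, (braidPerm n α ^ m) i = j := by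
  have := (Nat.card_eq_one_iff_unique.1 hα).1
  have h : (Quotient.mk _ j : ClosureComponent α) = Quotient.mk _ i := Subsingleton.elim _ _
  obtain ⟨⟨_, m, rfl⟩, hm⟩ := (MulAction.orbitRel_apply.1 (Quotient.exact h))
  exact ⟨m, hm⟩

theorem pos_of_knot {α : BraidGroup n} (hα : ClosureIsKnot α) : 0 < n := by
  obtain ⟨c⟩ := (Nat.card_eq_one_iff_unique.1 hα).2
  induction c using Quotient.inductionOn with
  | h i => exact i.pos

theorem sign_braidPerm (α : BraidGroup n) :
    Equiv.Perm.sign (braidPerm n α) = (-1 : ℤˣ) ^ expSum α := by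
  have : (Equiv.Perm.sign).comp (braidPerm n) =
      (zpowersHom ℤˣ (-1 : ℤˣ)).comp (braidExpHom n) := by
    refine PresentedGroup.ext fun i => ?_
    rw [MonoidHom.comp_apply, MonoidHom.comp_apply, braidPerm, braidExpHom,
      PresentedGroup.toGroup.of, PresentedGroup.toGroup.of, sTr,
      Equiv.Perm.sign_swap (lo_ne_hi i)]
    simp
  exact DFunLike.congr_fun this α

/-- The permutation acts transitively on the `m + 1` strands, so for `m > 0` it is a full cycle. A
single strand is separate because the identity is not a cycle for `IsCycle`. -/
theorem sign_of_knot {m : ℕ} {α : BraidGroup (m + 1)} (hα : ClosureIsKnot α) :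
    Equiv.Perm.sign (braidPerm (m + 1) α) = (-1 : ℤˣ) ^ m := by
  rcases Nat.eq_zero_or_pos m with rfl | hm
  · rw [Subsingleton.elim (braidPerm 1 α) 1]
    simp
  have hfix : ∀ i, braidPerm (m + 1) α i ≠ i := by
    intro i hi
    have h1 : ∀ j, j = i := fun j => by
      obtain ⟨k, hk⟩ := exists_zpow_of_knot hα i j
      rw [← hk, Equiv.Perm.zpow_apply_eq_self_of_apply_eq_self hi]
    have h2 := (h1 0).trans (h1 (Fin.last m)).symm
    simp [Fin.ext_iff] at h2
    omega
  have hc : (braidPerm (m + 1) α).IsCycle :=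
    ⟨0, hfix 0, fun j _ => exists_zpow_of_knot hα 0 j⟩
  have hs : (braidPerm (m + 1) α).support = Finset.univ :=
    Finset.eq_univ_of_forall fun i => Equiv.Perm.mem_support.2 (hfix i)
  rw [hc.sign, hs, Finset.card_univ, Fintype.card_fin, pow_succ]
  simp

variable {d : ℕ} (q : ℂ)

theorem tF_braidPerm_mul (α : BraidGroup n) (j : Fin n) :
    tF d (braidPerm n α j) * braidToFramed d n α = braidToFramed d n α * tF d j := by
  let H : Subgroup (BraidGroup n) :=
    { carrier := {α | ∀ j, tF d (braidPerm n α j) * braidToFramed d n α =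
        braidToFramed d n α * tF d j}
      mul_mem' := by
        intro a b ha hb j
        rw [map_mul, map_mul, Equiv.Perm.mul_apply, ← mul_assoc, ha, mul_assoc, hb, mul_assoc]
      one_mem' := by intro j; simp
      inv_mem' := by
        intro a ha j
        have := ha ((braidPerm n a)⁻¹ j)
        rw [← Equiv.Perm.mul_apply, mul_inv_cancel, Equiv.Perm.one_apply] at this
        rw [map_inv, map_inv, eq_inv_mul_iff_mul_eq, ← mul_assoc, ← this, mul_inv_cancel_right] }
  refine braid_generated H (fun i j => ?_) α j
  rw [braidPerm, braidToFramed, PresentedGroup.toGroup.of, PresentedGroup.toGroup.of, tF_σF,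
    sTr_sTr]

theorem semiconj_δ (α : BraidGroup n) (j : Fin n) :
    SemiconjBy (δ d n q α) (t d q j) (t d q (braidPerm n α j)) := by
  change framedToY d n q (braidToFramed d n α) * framedToY d n q (tF d j) =
    framedToY d n q (tF d (braidPerm n α j)) * framedToY d n q (braidToFramed d n α)
  rw [← map_mul, ← map_mul, tF_braidPerm_mul]

variable [NeZero d] {K : Type*} [Field K] [Algebra ℂ K] {q} {x : ZMod d → ℂ} {z : K}

/-- For a knot, the trace does not see on which strand a colour projection is put. -/
theorem fieldTrace_colour_eq {α : BraidGroup n} (hα : ClosureIsKnot α) (k : ZMod d) (i j : Fin n)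
    {b : Y d n q} (hb : ∀ m, Commute b (t d q m)) :
    fieldTrace d q x z n (b * colour q k i * δ d n q α) =
      fieldTrace d q x z n (b * colour q k j * δ d n q α) := by
  let H : Subgroup (Equiv.Perm (Fin n)) :=
    { carrier := {p | ∀ j, fieldTrace d q x z n (b * colour q k (p j) * δ d n q α) =
        fieldTrace d q x z n (b * colour q k j * δ d n q α)}
      mul_mem' := by
        intro p p' hp hp' j
        rw [Equiv.Perm.mul_apply, hp, hp']
      one_mem' := fun j => rfl
      inv_mem' := by
        intro p hp j
        rw [← hp, ← Equiv.Perm.mul_apply, mul_inv_cancel, Equiv.Perm.one_apply] }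
  -- Pull the projection through `α`, bring it to the front by cyclicity, and commute it past `b`.
  -- The powers of this one permutation then reach every strand, the closure being a knot.
  have h : braidPerm n α ∈ H := by
    intro j
    rw [mul_assoc, ← (semiconj_colour q (semiconj_δ q α j) k).eq, ← mul_assoc, fieldTrace_comm,
      ← mul_assoc, (commute_colour q (hb j) k).eq]
  obtain ⟨m, hm⟩ := exists_zpow_of_knot hα j i
  rw [← hm]
  exact H.zpow_mem h m j

/-- The projections are moved to strand `i` one at a time by `fieldTrace_colour_eq`, where
idempotence merges them. -/
theorem fieldTrace_allColour_of_knot {α : BraidGroup n} (hα : ClosureIsKnot α) (k : ZMod d)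
    (i : Fin n) : fieldTrace d q x z n (allColour q n k * δ d n q α) =
      fieldTrace d q x z n (colour q k i * δ d n q α) := by
  have hpow : ∀ m, colour q k i ^ (m + 1) = colour q k i := fun m => by
    induction m with
    | zero => rw [zero_add, pow_one]
    | succ m ih => rw [pow_succ, ih, colour_mul_self]
  have hc : ∀ i j : Fin n, Commute (colour q k i) (t d q j) := fun i j =>
    (commute_colour q (t_commute q j i) k).symm
  -- The exponent `m` counts the projections already gathered on strand `i`.
  have key : ∀ (l : List (Fin n)) (m : ℕ),
      fieldTrace d q x z n (colour q k i ^ m * (l.map (colour q k)).prod * δ d n q α) =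
        fieldTrace d q x z n (colour q k i ^ (m + l.length) * δ d n q α) := by
    intro l
    induction l with
    | nil => intro m; simp
    | cons j l ih =>
      intro m
      have hl : ∀ p, Commute (l.map (colour q k)).prod (t d q p) := fun p =>
        Commute.list_prod_left _ _ fun y hy => by
          obtain ⟨j', _, rfl⟩ := List.mem_map.1 hy
          exact hc j' p
      have hb : ∀ p, Commute (colour q k i ^ m * (l.map (colour q k)).prod) (t d q p) :=
        fun p => ((hc i p).pow_left m).mul_left (hl p)
      rw [List.map_cons, List.prod_cons, ← (commute_colour q (hl j) k).eq, ← mul_assoc,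
        fieldTrace_colour_eq hα k j i hb, mul_assoc (_ ^ m), (commute_colour q (hl i) k).eq,
        ← mul_assoc, ← pow_succ, ih, List.length_cons, add_right_comm, add_assoc]
  have hn : colour q k i ^ n = colour q k i := by
    have := hpow (n - 1)
    rwa [Nat.sub_add_cancel i.pos] at this
  have h := key (List.finRange n) 0
  rw [← List.ofFn_eq_map, pow_zero, one_mul, List.length_finRange, zero_add,
    hn] at h
  exact h

/-- The trace of a braid whose closure is a knot, in terms of the Ocneanu trace. -/
theorem fieldTrace_of_knot (hx : IsESolution d x) {m : ℕ} {α : BraidGroup (m + 1)}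
    (hα : ClosureIsKnot α) : fieldTrace d q x z (m + 1) (δ d (m + 1) q α) =
      algebraMap ℂ K (E d x) ^ m *
        fieldTrace 1 q (fun _ => 1) (z / algebraMap ℂ K (E d x)) (m + 1) (δ 1 (m + 1) q α) := by
  -- Insert the resolution of 1 on a single strand and write `E^m` as the sum of the `c_k^(m+1)`;
  -- the two sides then agree colour by colour.
  rw [← one_mul (δ d (m + 1) q α), ← sum_colour q (0 : Fin (m + 1)), Finset.sum_mul, map_sum,
    ← map_pow, ← sum_fourier_pow hx, map_sum, Finset.sum_mul]
  refine Finset.sum_congr rfl fun k _ => ?_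
  rw [← fieldTrace_allColour_of_knot hα, fieldTrace_allColour hx, toHecke_δ, map_pow]

end Knot

/-- The normalization factors for two square roots of the same element agree. -/
theorem normalization_eq {K : Type*} [Field K] {r r' : K} (h : r' ^ 2 = r ^ 2) (m : ℕ) (e : ℤ)
    (he : (-1 : ℤˣ) ^ e = (-1 : ℤˣ) ^ m) : (1 / r') ^ m * r' ^ e = (1 / r) ^ m * r ^ e := by
  -- For opposite roots the two sides differ by `(-1)^m (-1)^e`, which is 1 by the parity
  -- hypothesis.
  rcases sq_eq_sq_iff_eq_or_eq_neg.1 h with rfl | rfl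
  · rfl
  have he' : (-1 : K) ^ e = (-1 : K) ^ m := by
    have := congrArg (fun u : ℤˣ => ((Units.map (Int.castRingHom K : ℤ →* K) u : Kˣ) : K)) he
    simpa using this
  have h1 : ((-1 : K) ^ m) * (-1 : K) ^ m = 1 := by
    rw [← mul_pow]; simp
  have h2 : (1 / -r) ^ m = (-1 : K) ^ m * (1 / r) ^ m := by
    rw [← mul_pow]
    congr 1
    rw [one_div_neg_eq_neg_one_div]
    ring
  have h3 : (-r) ^ e = (-1 : K) ^ e * r ^ e := by rw [← mul_zpow]; simp
  rw [h2, h3, he']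
  linear_combination (1 / r) ^ m * r ^ e * h1

/-- For a knot, the invariant agrees with the Homflypt polynomial. -/
theorem Theta_eq_Homflypt {K : Type*} [Field K] [Algebra ℂ K] {d : ℕ} [NeZero d] {q : ℂ}
    {x : ZMod d → ℂ} (hx : IsESolution d x) {n : ℕ} {α : BraidGroup n} (hα : ClosureIsKnot α)
    {z r r' : K} (hr : r' ^ 2 = r ^ 2) :
    Theta d q x z r α = Homflypt q (z / algebraMap ℂ K (E d x)) r' α := by
  obtain ⟨m, rfl⟩ : ∃ m, n = m + 1 := ⟨n - 1, (Nat.sub_add_cancel (pos_of_knot hα)).symm⟩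
  have hE : algebraMap ℂ K (E d x) ≠ 0 := by
    rw [Ne, FaithfulSMul.algebraMap_eq_zero_iff]; exact E_ne_zero hx
  have h1 : Polynomial.aeval z (specTrace d q x (m + 1) (δ d (m + 1) q α)) =
      algebraMap ℂ K (E d x) ^ m * Polynomial.aeval (z / algebraMap ℂ K (E d x))
        (specTrace 1 q (fun _ => 1) (m + 1) (δ 1 (m + 1) q α)) := fieldTrace_of_knot hx hα
  have h2 := normalization_eq hr m (expSum α) (by rw [← sign_braidPerm, sign_of_knot hα])
  have hm : ((m + 1 : ℕ) : ℤ) - 1 = (m : ℤ) := by push_cast; ring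
  have h3 : 1 / (z * r) = 1 / z * (1 / r) := by rw [one_div_mul_one_div]
  -- The normalization at `z / E` supplies the factor `E^m` that `fieldTrace_of_knot` puts on the
  -- other side.
  have h4 : 1 / (z / algebraMap ℂ K (E d x) * r') =
      1 / z * algebraMap ℂ K (E d x) * (1 / r') := by
    rw [← one_div_mul_one_div, one_div_div]; ring
  rw [Homflypt, Theta, Theta, h1, hm, zpow_natCast, zpow_natCast, h3, h4, mul_pow, mul_pow,
    mul_pow]
  generalize Polynomial.aeval (z / algebraMap ℂ K (E d x))
        (specTrace 1 q (fun _ => 1) (m + 1) (δ 1 (m + 1) q α)) = V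
  linear_combination -((1 / z) ^ m * algebraMap ℂ K (E d x) ^ m * V) * h2

end YH

end

/-! ### The main theorem in both sets of variables -/

theorem mainTheorem1 {K : Type*} [Field K] [Algebra ℂ K] (d : ℕ) [NeZero d] (q : ℂ) (hq : q ≠ 0)
    (x : ZMod d → ℂ) (hx : YH.IsESolution d x) (n : ℕ) (α : YH.BraidGroup n)
    (hα : YH.ClosureIsKnot α) :
    (∀ z r r' : K, z ≠ 0 → YH.lam q (YH.E d x) z ≠ 0 →
      r ^ 2 = YH.lam q (YH.E d x) z →
      r' ^ 2 = YH.lam q 1 (z / algebraMap ℂ K (YH.E d x)) →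
      YH.Theta d q x z r α = YH.Homflypt q (z / algebraMap ℂ K (YH.E d x)) r' α) ∧
    (∀ l r r' : K, q ^ 2 ≠ 1 → l ≠ 0 → l ≠ 1 → r ^ 2 = l → r' ^ 2 = l →
      YH.Theta d q x (algebraMap ℂ K ((q - q⁻¹) * YH.E d x) / (1 - l)) r α =
        YH.Homflypt q (algebraMap ℂ K (q - q⁻¹) / (1 - l)) r' α) := by
  have hE : algebraMap ℂ K (YH.E d x) ≠ 0 := by
    rw [Ne, FaithfulSMul.algebraMap_eq_zero_iff]; exact YH.E_ne_zero hx
  refine ⟨fun z r r' hz _ hr hr' => YH.Theta_eq_Homflypt hx hα ?_,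
    fun l r r' _ _ _ hr hr' => ?_⟩
  -- Dividing `z` by `E` leaves `λ` unchanged when `E` is replaced by 1, so both roots have the same
  -- square.
  · rw [hr, hr', YH.lam, YH.lam, mul_one, map_mul]
    field_simp
  · rw [YH.Theta_eq_Homflypt hx hα (hr'.trans hr.symm), map_mul]
    congr 1
    field_simp
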